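/- Let $n\ge 0$, $T>0$, and consider the third order operator with coefficients depending only on time $$\partial_t^3+\sum_{j=0}^{2}\ \sum_{|\alpha|\le 3-j}a_{j,\alpha}(t)\,\partial_t^j\partial_x^\alpha ,\qquad t\in[0,T],\ x\in\mathbb R^n ,$$ where the complex-valued coefficients $a_{j,\alpha}$ are (real-)analytic in a neighbourhood of $[0,T]$. Put $$L(t,\tau,\xi)=\tau^3+\sum_{j\le 2,\ j+|\alpha|=3}a_{j,\alpha}(t)\tau^j\xi^\alpha,\quad M(t,\tau,\xi)=\sum_{j+|\alpha|=2}a_{j,\alpha}(t)\tau^j\xi^\alpha,\quad N(t,\tau,\xi)=\sum_{j+|\alpha|=1}a_{j,\alpha}(t)\tau^j\xi^\alpha ,$$ and assume weak hyperbolicity: for all $t\in[0,T]$ and $\xi\in\mathbb R^n$ all roots $\tau$ of $L(t,\cdot,\xi)$ are real. Define $$\mathcal L=L-\partial_\tau^2L,\qquad \check M=M-\tfrac12\partial_t\partial_\tau L,\qquad \check N=N-\tfrac12\partial_t\partial_\tau M+\tfrac1{12}\partial_t^2\partial_\tau^2L .$$ Then, for all $t\in[0,T]$ and $\xi\in\mathbb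 R^n$, the roots $\lambda_1(t,\xi)<\lambda_2(t,\xi)<\lambda_3(t,\xi)$ of $\mathcal L(t,\cdot,\xi)$ and the roots $\mu_1(t,\xi)<\mu_2(t,\xi)$ of $\partial_\tau\mathcal L(t,\cdot,\xi)$ are real and distinct, and for each $\xi$ they are analytic functions of $t\in[0,T]$. Moreover, with $S_2=\{(1,2),(2,3),(3,1)\}$: there is a constant $C>0$ such that for all $\xi\in\mathbb R^n$ $$\text{(E-1)}\quad \int_0^T\sum_{(j,k)\in S_2}\frac{|\partial_t\lambda_j(t,\xi)-\partial_t\lambda_k(t,\xi)|}{|\lambda_j(t,\xi)-\lambda_k(t,\xi)|}\,dt\le C\log(1+|\xi|),$$ $$\text{(E-2)}\quad \int_0^T\sum_{(j,k)\in S_2}\frac{|\partial_t^2\lambda_j(t,\xi)-\partial_t^2\lambda_k(t,\xi)|}{|\partial_t\lambda_j(t,\xi)-\partial_t\lambda_k(t,\xi)|+1}\,dt\le C\log(1+|\xi|);$$ and for every $R>0$ there is a constant $C>0$ such that for all $\xi\in\mathbb R^n$ with $|\xi|\ge R$ $$\text{(E-3)}\quad \int_0^T\sum_{j=1}^3\frac{\bigl|\partial_t\bigl[\check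 M(t,\lambda_j(t,\xi),\xi)\bigr]\bigr|}{|\check M(t,\lambda_j(t,\xi),\xi)|+1}\,dt\le C\log(1+|\xi|),$$ $$\text{(E-4)}\quad \int_0^T\sum_{j=1}^2\frac{\bigl|\partial_t\bigl[\check N(t,\mu_j(t,\xi),\xi)\bigr]\bigr|}{|\check N(t,\mu_j(t,\xi),\xi)|+1}\,dt\le C\log(1+|\xi|).$$ In particular all these integrals converge. -/

import Mathlib

open MeasureTheory

noncomputable section

namespace ThirdOrder

open Polynomial

/-- The coefficients `a j α t` of the third order operator
`∂ₜ³ + ∑_{j ≤ 2} ∑_{|α| ≤ 3 - j} a j α (t) ∂ₜʲ ∂ₓ^α` on `ℝⁿ`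
(the entries outside this range of indices are never used). -/
abbrev Coeffs (n : ℕ) : Type := ℕ → (Fin n → ℕ) → ℝ → ℂ

variable {n : ℕ}

/-- `∑_{|α| = k} a_{j,α}(t) ξ^α`. -/
def coeffSum (a : Coeffs n) (j k : ℕ) (t : ℝ) (ξ : EuclideanSpace ℝ (Fin n)) : ℂ :=
  ∑ α ∈ Finset.piAntidiag (Finset.univ : Finset (Fin n)) k,
    a j α t * ∏ i, (ξ i : ℂ) ^ α i

/-- The principal symbol `L(t,τ,ξ)`, as a polynomial in `τ`. -/
def symL (a : Coeffs n) (t : ℝ) (ξ : EuclideanSpace ℝ (Fin n)) : ℂ[X] :=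
  X ^ 3 + ∑ j ∈ Finset.range 3, C (coeffSum a j (3 - j) t ξ) * X ^ j

/-- The symbol `M(t,τ,ξ)` of the terms of order two. -/
def symM (a : Coeffs n) (t : ℝ) (ξ : EuclideanSpace ℝ (Fin n)) : ℂ[X] :=
  ∑ j ∈ Finset.range 3, C (coeffSum a j (2 - j) t ξ) * X ^ j

/-- The symbol `N(t,τ,ξ)` of the terms of order one. -/
def symN (a : Coeffs n) (t : ℝ) (ξ : EuclideanSpace ℝ (Fin n)) : ℂ[X] :=
  ∑ j ∈ Finset.range 2, C (coeffSum a j (1 - j) t ξ) * X ^ j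

/-- The coefficients of the operator are analytic on `[0,T]`
(that is, in a neighbourhood of each point of `[0,T]`). -/
def AnalyticCoeffs (a : Coeffs n) (T : ℝ) : Prop :=
  ∀ (j : ℕ) (α : Fin n → ℕ), j ≤ 2 → j + ∑ i, α i ≤ 3 →
    AnalyticOnNhd ℝ (a j α) (Set.Icc 0 T)

/-- Weak hyperbolicity: `L(t,·,ξ)` has only real roots. -/
def WeaklyHyperbolic (a : Coeffs n) (T : ℝ) : Prop :=
  ∀ t ∈ Set.Icc 0 T, ∀ (ξ : EuclideanSpace ℝ (Fin n)) (z : ℂ),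
    (symL a t ξ).eval z = 0 → z.im = 0

/-- The auxiliary polynomial `L - ∂_τ² L`. -/
def auxL (a : Coeffs n) (t : ℝ) (ξ : EuclideanSpace ℝ (Fin n)) : ℂ[X] :=
  symL a t ξ - derivative (derivative (symL a t ξ))

/-- For a polynomial with only real roots: the `k`-th root (`k = 0, 1, …`), the roots being listed
in increasing order with multiplicity. -/
def orderedRoot (p : ℂ[X]) (k : ℕ) : ℝ :=
  ((p.roots.map Complex.re).sort (· ≤ ·)).getD k 0

/-- The roots `λ₁ ≤ λ₂ ≤ λ₃` of the auxiliary polynomial. -/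
def lam (a : Coeffs n) (j : Fin 3) (t : ℝ) (ξ : EuclideanSpace ℝ (Fin n)) : ℝ :=
  orderedRoot (auxL a t ξ) j

/-- The roots `μ₁ ≤ μ₂` of the `τ`-derivative of the auxiliary polynomial. -/
def mu (a : Coeffs n) (j : Fin 2) (t : ℝ) (ξ : EuclideanSpace ℝ (Fin n)) : ℝ :=
  orderedRoot (derivative (auxL a t ξ)) j

/-- `M - (1/2) ∂ₜ ∂_τ L`. -/
def checkM (a : Coeffs n) (t : ℝ) (τ : ℂ) (ξ : EuclideanSpace ℝ (Fin n)) : ℂ :=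
  (symM a t ξ).eval τ - 1 / 2 * deriv (fun s => (derivative (symL a s ξ)).eval τ) t

/-- `N - (1/2) ∂ₜ ∂_τ M + (1/12) ∂ₜ² ∂_τ² L`. -/
def checkN (a : Coeffs n) (t : ℝ) (τ : ℂ) (ξ : EuclideanSpace ℝ (Fin n)) : ℂ :=
  (symN a t ξ).eval τ - 1 / 2 * deriv (fun s => (derivative (symM a s ξ)).eval τ) t
    + 1 / 12 * iteratedDeriv 2 (fun s => (derivative (derivative (symL a s ξ))).eval τ) t

/-- The pairs `(1,2), (2,3), (3,1)`, with indices shifted by one. -/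
def S2 : Finset (Fin 3 × Fin 3) := {(0, 1), (1, 2), (2, 0)}

/-- The logarithmic condition `∫₀ᵀ |F(t,ξ)| dt ≲ log (1 + |ξ|)`, uniformly for `ξ ∈ S`. -/
def LogCondition (T : ℝ) (S : Set (EuclideanSpace ℝ (Fin n)))
    (F : ℝ → EuclideanSpace ℝ (Fin n) → ℝ) : Prop :=
  (∀ ξ ∈ S, IntervalIntegrable (fun t => F t ξ) volume 0 T) ∧
  ∃ C : ℝ, 0 < C ∧ ∀ ξ ∈ S, ∫ t in (0 : ℝ)..T, |F t ξ| ≤ C * Real.log (1 + ‖ξ‖)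

/-- `∑ |∂ₜλⱼ - ∂ₜλₖ| / |λⱼ - λₖ|`. -/
def integrand1 (a : Coeffs n) (t : ℝ) (ξ : EuclideanSpace ℝ (Fin n)) : ℝ :=
  ∑ p ∈ S2, |deriv (fun s => lam a p.1 s ξ) t - deriv (fun s => lam a p.2 s ξ) t| /
    |lam a p.1 t ξ - lam a p.2 t ξ|

/-- `∑ |∂ₜ²λⱼ - ∂ₜ²λₖ| / (|∂ₜλⱼ - ∂ₜλₖ| + 1)`. -/
def integrand2 (a : Coeffs n) (t : ℝ) (ξ : EuclideanSpace ℝ (Fin n)) : ℝ :=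
  ∑ p ∈ S2, |iteratedDeriv 2 (fun s => lam a p.1 s ξ) t
      - iteratedDeriv 2 (fun s => lam a p.2 s ξ) t| /
    (|deriv (fun s => lam a p.1 s ξ) t - deriv (fun s => lam a p.2 s ξ) t| + 1)

/-- `∑ |∂ₜ [M̌(t,λⱼ(t,ξ),ξ)]| / (|M̌(t,λⱼ(t,ξ),ξ)| + 1)`. -/
def integrand3 (a : Coeffs n) (t : ℝ) (ξ : EuclideanSpace ℝ (Fin n)) : ℝ :=
  ∑ j : Fin 3, ‖deriv (fun s => checkM a s (lam a j s ξ) ξ) t‖ /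
    (‖checkM a t (lam a j t ξ) ξ‖ + 1)

/-- `∑ |∂ₜ [Ň(t,μⱼ(t,ξ),ξ)]| / (|Ň(t,μⱼ(t,ξ),ξ)| + 1)`. -/
def integrand4 (a : Coeffs n) (t : ℝ) (ξ : EuclideanSpace ℝ (Fin n)) : ℝ :=
  ∑ j : Fin 2, ‖deriv (fun s => checkN a s (mu a j s ξ) ξ) t‖ /
    (‖checkN a t (mu a j t ξ) ξ‖ + 1)

/-- The `λⱼ` and `μⱼ` really are the roots of the auxiliary polynomial and of its `τ`-derivative,
they are distinct, and they depend analytically on `t ∈ [0,T]`. -/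
def RootsRegular (a : Coeffs n) (T : ℝ) : Prop :=
  ∀ ξ : EuclideanSpace ℝ (Fin n),
    (∀ t ∈ Set.Icc 0 T,
      auxL a t ξ = ∏ j : Fin 3, (X - C (lam a j t ξ : ℂ)) ∧
      lam a 0 t ξ < lam a 1 t ξ ∧ lam a 1 t ξ < lam a 2 t ξ ∧
      derivative (auxL a t ξ) = C 3 * ∏ j : Fin 2, (X - C (mu a j t ξ : ℂ)) ∧
      mu a 0 t ξ < mu a 1 t ξ) ∧
    (∀ j : Fin 3, AnalyticOn ℝ (fun t => lam a j t ξ) (Set.Icc 0 T)) ∧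
    (∀ j : Fin 2, AnalyticOn ℝ (fun t => mu a j t ξ) (Set.Icc 0 T))

end ThirdOrder

end

/-! For real `g` the quotient `|∂ₜg| / (|g| + 1)` is at most `|∂ₜ arsinh g|`, so its integral is
bounded by the total variation of `arsinh g(·,ξ)`. If `g` grows at most polynomially in `ξ`, then
`arsinh g = O(log (2 + |ξ|))`. If moreover `∂ₜg(·,ξ)` vanishes identically or has at most `N` zeros
in `(0,T)`, with `N` independent of `ξ`, then the variation is at most `2(N+1)` times that bound
(`DTame.logBdd`). Hence only polynomial growth and a uniform zero count are needed.

Both come from algebra. The coefficients are finite sums of products `b(t) p(ξ)`; for fixed `ξ` such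
a sum lies in a fixed finite-dimensional space of analytic functions, whose nonzero elements have
boundedly many zeros, by Rolle's theorem and Wronskians (`exists_zeroBound_sum`). Growth and zero
count pass to fractions with denominator bounded below, and then to analytic functions integral over
the ring of these fractions (`Tame`): growth by Cauchy's root bound (`Tame.polyBddOn`), zeros by the
lowest nonvanishing coefficient of the integral equation (`Tame.exists_zeroBound`). Integral
elements form a ring, so everything built polynomially stays tame.

The roots `λⱼ` are integral. Differentiating them introduces the inverse of `∂_τ ℒ` at `λⱼ`, which
is again tame because the discriminant of `ℒ` is bounded below: in the centred variable `L = u³ - p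
u - q` and `L - L'' = u³ - (p + 6) u - q` (`gap_bounds`, `tame_root`). The `μⱼ` are handled by the
quadratic formula (`tame_sqrt`), and `M̌`, `Ň` at the roots are polynomial expressions in tame
functions.

This gives bounds by `log (2 + |ξ|)`, which suffice for `|ξ| ≥ R`. For (E-1) and (E-2) near `ξ = 0`
the `t`-derivatives of `λⱼ` are `O(|ξ|)`, since the nonleading coefficients of `L` have positive
degree in `ξ` (`LogBdd.logCondition_univ`). -/

namespace ThirdOrder

/-! ### Zero counts in finite-dimensional spaces of analytic functions. -/

open Set Filter Topology

/-- On `s` the function `f` vanishes identically or has at most `N` zeros. -/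
def ZeroBound (s : Set ℝ) (N : ℕ) (f : ℝ → ℝ) : Prop :=
  (∀ t ∈ s, f t = 0) ∨ ∃ Z : Finset ℝ, Z.card ≤ N ∧ ∀ t ∈ s, f t = 0 → t ∈ Z

lemma ZeroBound.of_zero_imp {s : Set ℝ} {N : ℕ} {f g : ℝ → ℝ} (h : ZeroBound s N f)
    (hfg : ∀ t ∈ s, g t = 0 ↔ f t = 0) : ZeroBound s N g :=
  h.imp (fun h t ht => (hfg t ht).2 (h t ht))
    fun ⟨Z, hZ, hf⟩ => ⟨Z, hZ, fun t ht h0 => hf t ht ((hfg t ht).1 h0)⟩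

/-- Infinitely many zeros would accumulate in the compact `[0,T]`, and the identity theorem applies
there because analyticity includes the endpoints. -/
lemma exists_zeroBound_of_analyticOnNhd {T : ℝ} {f : ℝ → ℝ}
    (hf : AnalyticOnNhd ℝ f (Icc 0 T)) : ∃ N, ZeroBound (Ioo 0 T) N f := by
  by_cases hfin : (Icc 0 T ∩ {t | f t = 0}).Finite
  · refine ⟨_, Or.inr ⟨hfin.toFinset, le_rfl, fun t ht h0 => ?_⟩⟩
    simpa [h0] using Ioo_subset_Icc_self ht
  · obtain ⟨x, hx, hacc⟩ := Set.Infinite.exists_accPt_of_subset_isCompact hfin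
      (isCompact_Icc (a := (0 : ℝ)) (b := T)) inter_subset_left
    refine ⟨0, Or.inl fun t ht => ?_⟩
    refine hf.eqOn_zero_of_preconnected_of_frequently_eq_zero isPreconnected_Icc hx ?_
      (Ioo_subset_Icc_self ht)
    rw [accPt_iff_frequently_nhdsNE] at hacc
    exact hacc.mono fun y hy => hy.2

/-- Rolle's theorem for a quotient. -/
lemma exists_wronskian_eq_zero {f b : ℝ → ℝ} {x y : ℝ} (hxy : x < y)
    (hf : ∀ t ∈ Icc x y, DifferentiableAt ℝ f t) (hb : ∀ t ∈ Icc x y, DifferentiableAt ℝ b t)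
    (hb0 : ∀ t ∈ Icc x y, b t ≠ 0) (hx : f x = 0) (hy : f y = 0) :
    ∃ z ∈ Ioo x y, deriv f z * b z - f z * deriv b z = 0 := by
  obtain ⟨z, hz, h⟩ := exists_deriv_eq_zero (f := fun t => f t / b t) hxy
    (fun t ht => ((hf t ht).div (hb t ht) (hb0 t ht)).continuousAt.continuousWithinAt)
    (by simp [hx, hy])
  refine ⟨z, hz, ?_⟩
  have hz' := Ioo_subset_Icc_self hz
  rw [deriv_fun_div (hf z hz') (hb z hz') (hb0 z hz'), div_eq_zero_iff] at h
  exact h.resolve_right (pow_ne_zero _ (hb0 z hz'))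

/-- Between two zeros of `f` off the zero set of `b` there is a zero of `b`, or Rolle for `f / b`
gives a zero of the Wronskian. So at most `B + W + 1` zeros lie off that set, and at most `B` on it.
-/
lemma zeroBound_of_wronskian {T : ℝ} {f b : ℝ → ℝ} {B W : ℕ}
    (hf : AnalyticOnNhd ℝ f (Ioo 0 T)) (hb : AnalyticOnNhd ℝ b (Ioo 0 T))
    (hbne : ¬ ∀ t ∈ Ioo 0 T, b t = 0) (hB : ZeroBound (Ioo 0 T) B b)
    (hW : ZeroBound (Ioo 0 T) W fun t => deriv f t * b t - f t * deriv b t) :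
    ZeroBound (Ioo 0 T) (B + (B + W + 1)) f := by
  obtain ⟨Zb, hZb, hZb'⟩ := hB.resolve_left hbne
  by_cases hf0 : ∀ t ∈ Ioo 0 T, f t = 0
  · exact Or.inl hf0
  refine Or.inr ?_
  rcases hW with hW | ⟨Zw, hZw, hZw'⟩
  -- If the Wronskian vanishes identically, `f / b` is locally constant where `b ≠ 0`; a zero of `f`
  -- there would force `f ≡ 0`.
  · refine ⟨Zb, by omega, fun t ht h0 => hZb' t ht ?_⟩
    by_contra hbt
    apply hf0
    refine hf.eqOn_zero_of_preconnected_of_eventuallyEq_zero isPreconnected_Ioo ht ?_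
    have hev : ∀ᶠ s in 𝓝 t, s ∈ Ioo 0 T ∧ b s ≠ 0 :=
      (isOpen_Ioo.eventually_mem ht).and ((hb t ht).continuousAt.eventually_ne hbt)
    obtain ⟨ε, hε, hball⟩ := Metric.eventually_nhds_iff_ball.1 hev
    have hconst : ∀ s ∈ Metric.ball t ε, f s / b s = f t / b t := by
      intro s hs
      refine Metric.isOpen_ball.is_const_of_deriv_eq_zero (f := fun s => f s / b s)
        (convex_ball t ε).isPreconnected ?_ ?_ hs (Metric.mem_ball_self hε)
      · intro u hu
        exact (((hf u (hball u hu).1).differentiableAt).div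
          ((hb u (hball u hu).1).differentiableAt) (hball u hu).2).differentiableWithinAt
      · intro u hu
        have hu' := hball u hu
        have := hW u hu'.1
        simp only at this
        rw [deriv_fun_div (hf u hu'.1).differentiableAt (hb u hu'.1).differentiableAt hu'.2, this]
        simp
    filter_upwards [Metric.ball_mem_nhds t hε] with s hs
    have := hconst s hs
    rw [h0, zero_div, div_eq_zero_iff] at this
    exact this.resolve_right (hball s hs).2
  · have key : ∀ S : Finset ℝ, (∀ t ∈ S, t ∈ Ioo 0 T ∧ f t = 0 ∧ t ∉ Zb) →
        S.card ≤ B + W + 1 := by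
      intro S hS
      have := Finset.card_le_of_interleaved (s := S) (t := Zb ∪ Zw) (by
        intro x hx y hy hxy _
        obtain ⟨hx1, hx2, hx3⟩ := hS x hx
        obtain ⟨hy1, hy2, hy3⟩ := hS y hy
        have hsub : Icc x y ⊆ Ioo 0 T := fun t ht => ⟨hx1.1.trans_le ht.1, ht.2.trans_lt hy1.2⟩
        by_cases hbz : ∃ z ∈ Ioo x y, b z = 0
        · obtain ⟨z, hz, hz0⟩ := hbz
          exact ⟨z, Finset.mem_union_left _ (hZb' z (hsub (Ioo_subset_Icc_self hz)) hz0),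
            hz.1, hz.2⟩
        · push Not at hbz
          obtain ⟨z, hz, hz0⟩ := exists_wronskian_eq_zero (f := f) (b := b) hxy
            (fun t ht => (hf t (hsub ht)).differentiableAt)
            (fun t ht => (hb t (hsub ht)).differentiableAt)
            (by
              intro t ht h0
              rcases eq_or_lt_of_le ht.1 with h | h
              · exact hx3 (hZb' x hx1 (by rw [h, h0]))
              rcases eq_or_lt_of_le ht.2 with h' | h'
              · exact hy3 (hZb' y hy1 (by rw [← h', h0]))
              exact hbz t ⟨h, h'⟩ h0) hx2 hy2
          exact ⟨z, Finset.mem_union_right _ (hZw' z (hsub (Ioo_subset_Icc_self hz)) hz0),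
            hz.1, hz.2⟩)
      have h2 := Finset.card_union_le Zb Zw
      omega
    have hfin : {t | t ∈ Ioo 0 T ∧ f t = 0 ∧ t ∉ Zb}.Finite := by
      by_contra hinf
      obtain ⟨S, hS, hcard⟩ := Set.Infinite.exists_subset_card_eq hinf (B + W + 2)
      have := key S fun t ht => hS ht
      omega
    have := key hfin.toFinset (by simp)
    refine ⟨Zb ∪ hfin.toFinset, (Finset.card_union_le _ _).trans (by omega), fun t ht h0 => ?_⟩
    by_cases htb : t ∈ Zb
    · exact Finset.mem_union_left _ htb
    · exact Finset.mem_union_right _ (hfin.mem_toFinset.2 ⟨ht, h0, htb⟩)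

/-- The number of zeros of the nonzero elements of a finite-dimensional space of analytic functions
on a compact interval is uniformly bounded. -/
theorem exists_zeroBound_sum {T : ℝ} (m : ℕ) (b : Fin m → ℝ → ℝ)
    (hb : ∀ k, AnalyticOnNhd ℝ (b k) (Icc 0 T)) :
    ∃ N, ∀ c : Fin m → ℝ, ZeroBound (Ioo 0 T) N fun t => ∑ k, c k * b k t := by
  induction m with
  | zero => exact ⟨0, fun c => Or.inl (by simp)⟩
  | succ m ih =>
    by_cases h0 : ∀ t ∈ Ioo 0 T, b 0 t = 0
    · obtain ⟨N, hN⟩ := ih (fun k => b k.succ) fun k => hb _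
      refine ⟨N, fun c => (hN fun k => c k.succ).of_zero_imp fun t ht => ?_⟩
      simp [Fin.sum_univ_succ, h0 t ht]
    · obtain ⟨B, hB⟩ := exists_zeroBound_of_analyticOnNhd (hb 0)
      -- The Wronskian with `b 0` eliminates the coefficient of `b 0`: what remains is a
      -- combination, with the other coefficients unchanged, of `m` fixed analytic functions.
      obtain ⟨W, hW⟩ := ih (fun k t => deriv (b k.succ) t * b 0 t - b k.succ t * deriv (b 0) t)
        fun k => ((hb _).deriv.mul (hb 0)).sub ((hb _).mul (hb 0).deriv)
      refine ⟨B + (B + W + 1), fun c => zeroBound_of_wronskian (b := b 0) ?_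
        ((hb 0).mono Ioo_subset_Icc_self) h0 hB
        ((hW fun k => c k.succ).of_zero_imp fun t ht => ?_)⟩
      · exact Finset.analyticOnNhd_fun_sum _ fun k _ =>
          analyticOnNhd_const.mul ((hb k).mono Ioo_subset_Icc_self)
      · have hd : ∀ k, DifferentiableAt ℝ (b k) t :=
          fun k => (hb k t (Ioo_subset_Icc_self ht)).differentiableAt
        rw [deriv_fun_sum fun k _ => (hd k).const_mul _]
        refine Eq.congr_left ?_
        simp only [deriv_const_mul _ (hd _), Fin.sum_univ_succ, add_mul, mul_sub,
          Finset.sum_sub_distrib, Finset.sum_mul, mul_assoc]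
        ring

end ThirdOrder

/-! ### Separated sums, their fractions, and integral elements. -/

namespace ThirdOrder

open Set Filter Topology

variable {E : Type*} {T : ℝ}

/-- For `t ∈ (0,T)`, `g` is a finite sum of products `b(t) p(ξ)`, with `b` analytic on `[0,T]` and
`p` subject to the condition `Q`. -/
def SepSum (T : ℝ) (Q : (E → ℝ) → Prop) (g : ℝ → E → ℝ) : Prop :=
  ∃ (ι : Type) (_ : Fintype ι) (b : ι → ℝ → ℝ) (p : ι → E → ℝ),
    (∀ k, AnalyticOnNhd ℝ (b k) (Icc 0 T)) ∧ (∀ k, Q (p k)) ∧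
      ∀ t ∈ Ioo 0 T, ∀ ξ, g t ξ = ∑ k, b k t * p k ξ

/-- The derivative with respect to the first variable. -/
noncomputable def dt (g : ℝ → E → ℝ) (t : ℝ) (ξ : E) : ℝ := deriv (fun s => g s ξ) t

lemma SepSum.analyticOnNhd {Q : (E → ℝ) → Prop} {g : ℝ → E → ℝ} (hg : SepSum T Q g) (ξ : E) :
    AnalyticOnNhd ℝ (fun t => g t ξ) (Ioo 0 T) := by
  obtain ⟨ι, _, b, p, hb, -, h⟩ := hg
  refine AnalyticOnNhd.congr isOpen_Ioo (f := fun t => ∑ k, b k t * p k ξ) ?_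
    fun t ht => (h t ht ξ).symm
  exact Finset.analyticOnNhd_fun_sum _ fun k _ =>
    ((hb k).mono Ioo_subset_Icc_self).mul analyticOnNhd_const

lemma SepSum.dt {Q : (E → ℝ) → Prop} {g : ℝ → E → ℝ} (hg : SepSum T Q g) :
    SepSum T Q (dt g) := by
  obtain ⟨ι, _, b, p, hb, hp, h⟩ := hg
  refine ⟨ι, inferInstance, fun k => deriv (b k), p, fun k => (hb k).deriv, hp, fun t ht ξ => ?_⟩
  have heq : (fun s => g s ξ) =ᶠ[𝓝 t] fun s => ∑ k, b k s * p k ξ := by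
    filter_upwards [isOpen_Ioo.mem_nhds ht] with s hs using h s hs ξ
  have hd : ∀ k, DifferentiableAt ℝ (b k) t :=
    fun k => (hb k t (Ioo_subset_Icc_self ht)).differentiableAt
  rw [ThirdOrder.dt, heq.deriv_eq, deriv_fun_sum fun k _ => (hd k).mul_const _]
  simp only [deriv_mul_const (hd _)]

lemma SepSum.congr {Q : (E → ℝ) → Prop} {f g : ℝ → E → ℝ} (hf : SepSum T Q f)
    (h : ∀ t ∈ Ioo 0 T, ∀ ξ, g t ξ = f t ξ) : SepSum T Q g := by
  obtain ⟨ι, i, b, p, hb, hp, hf⟩ := hf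
  exact ⟨ι, i, b, p, hb, hp, fun t ht ξ => (h t ht ξ).trans (hf t ht ξ)⟩

/-- The variable `ξ` enters only through the constants `p k ξ`, so the bound for the span of the `b
k` is uniform in `ξ`. -/
lemma SepSum.exists_zeroBound {Q : (E → ℝ) → Prop} {g : ℝ → E → ℝ} (hg : SepSum T Q g) :
    ∃ N, ∀ ξ, ZeroBound (Ioo 0 T) N fun t => g t ξ := by
  obtain ⟨ι, _, b, p, hb, -, h⟩ := hg
  let e := (Fintype.equivFin ι).symm
  obtain ⟨N, hN⟩ := exists_zeroBound_sum _ (fun k => b (e k)) fun k => hb _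
  refine ⟨N, fun ξ => (hN fun k => p (e k) ξ).of_zero_imp fun t ht => ?_⟩
  rw [h t ht ξ, ← e.sum_comp]
  simp only [mul_comm]

variable [NormedAddCommGroup E]

/-- `f` is bounded by a polynomial in `‖ξ‖`, uniformly for `t ∈ s`. -/
def PolyBddOn (s : Set ℝ) (f : ℝ → E → ℝ) : Prop :=
  ∃ (C : ℝ) (m : ℕ), 0 ≤ C ∧ ∀ t ∈ s, ∀ ξ, |f t ξ| ≤ C * (1 + ‖ξ‖) ^ m

lemma PolyBddOn.add {s : Set ℝ} {f g : ℝ → E → ℝ} (hf : PolyBddOn s f) (hg : PolyBddOn s g) :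
    PolyBddOn s (f + g) := by
  obtain ⟨C, m, hC, hf⟩ := hf
  obtain ⟨D, k, hD, hg⟩ := hg
  refine ⟨C + D, m + k, by positivity, fun t ht ξ => ?_⟩
  have h1 : 1 ≤ 1 + ‖ξ‖ := by linarith [norm_nonneg ξ]
  calc |f t ξ + g t ξ| ≤ |f t ξ| + |g t ξ| := abs_add_le _ _
    _ ≤ C * (1 + ‖ξ‖) ^ m + D * (1 + ‖ξ‖) ^ k := add_le_add (hf t ht ξ) (hg t ht ξ)
    _ ≤ C * (1 + ‖ξ‖) ^ (m + k) + D * (1 + ‖ξ‖) ^ (m + k) := by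
        gcongr <;> first | exact h1 | omega
    _ = _ := by ring

lemma PolyBddOn.mul {s : Set ℝ} {f g : ℝ → E → ℝ} (hf : PolyBddOn s f) (hg : PolyBddOn s g) :
    PolyBddOn s (f * g) := by
  obtain ⟨C, m, hC, hf⟩ := hf
  obtain ⟨D, k, hD, hg⟩ := hg
  refine ⟨C * D, m + k, by positivity, fun t ht ξ => ?_⟩
  calc |f t ξ * g t ξ| = |f t ξ| * |g t ξ| := abs_mul _ _
    _ ≤ (C * (1 + ‖ξ‖) ^ m) * (D * (1 + ‖ξ‖) ^ k) :=
        mul_le_mul (hf t ht ξ) (hg t ht ξ) (abs_nonneg _) (by positivity)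
    _ = _ := by ring

lemma PolyBddOn.of_bounded {s : Set ℝ} {f : ℝ → E → ℝ} {C : ℝ}
    (h : ∀ t ∈ s, ∀ ξ, |f t ξ| ≤ C) : PolyBddOn s f :=
  ⟨|C|, 0, abs_nonneg _, fun t ht ξ => by simpa using (h t ht ξ).trans (le_abs_self C)⟩

lemma PolyBddOn.mono {s : Set ℝ} {f g : ℝ → E → ℝ} (hf : PolyBddOn s f)
    (h : ∀ t ∈ s, ∀ ξ, |g t ξ| ≤ |f t ξ|) : PolyBddOn s g := by
  obtain ⟨C, m, hC, hf⟩ := hf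
  exact ⟨C, m, hC, fun t ht ξ => (h t ht ξ).trans (hf t ht ξ)⟩

lemma PolyBddOn.sum {s : Set ℝ} {ι : Type*} (S : Finset ι) {f : ι → ℝ → E → ℝ}
    (hf : ∀ i ∈ S, PolyBddOn s (f i)) : PolyBddOn s (∑ i ∈ S, f i) :=
  Finset.sum_induction f (PolyBddOn s) (fun _ _ => PolyBddOn.add)
    (PolyBddOn.of_bounded (C := 0) (by simp)) hf

/-- `p` is bounded by a polynomial in `‖ξ‖`. -/
def PolyBdd (p : E → ℝ) : Prop := PolyBddOn univ fun _ => p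

lemma PolyBdd.polyBddOn {p : E → ℝ} (hp : PolyBdd p) (s : Set ℝ) : PolyBddOn s fun _ => p := by
  obtain ⟨C, m, hC, h⟩ := hp
  exact ⟨C, m, hC, fun t _ => h t (mem_univ t)⟩

lemma PolyBdd.mul {p q : E → ℝ} (hp : PolyBdd p) (hq : PolyBdd q) : PolyBdd (p * q) :=
  PolyBddOn.mul hp hq

lemma polyBdd_const (c : ℝ) : PolyBdd fun _ : E => c :=
  PolyBddOn.of_bounded (C := |c|) (by simp)

lemma SepSum.polyBddOn {g : ℝ → E → ℝ} (hg : SepSum T PolyBdd g) : PolyBddOn (Ioo 0 T) g := by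
  obtain ⟨ι, _, b, p, hb, hp, h⟩ := hg
  refine PolyBddOn.mono (f := ∑ k, fun t ξ => b k t * p k ξ) (PolyBddOn.sum _ fun k _ => ?_)
    fun t ht ξ => by simp [h t ht ξ, Finset.sum_apply]
  obtain ⟨C, hC⟩ := isCompact_Icc.exists_bound_of_continuousOn (hb k).continuousOn
  exact (PolyBddOn.of_bounded (f := fun t _ => b k t) (C := C)
    fun t ht _ => hC t (Ioo_subset_Icc_self ht)).mul ((hp k).polyBddOn _)

variable (E T) in
/-- The algebra of finite sums of products `b(t) p(ξ)`, with `b` analytic on `[0,T]` and `p`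
polynomially bounded; there is no condition on the values for `t ∉ (0,T)`. -/
def sepAlg : Subalgebra ℝ (ℝ → E → ℝ) where
  carrier := {g | SepSum T PolyBdd g}
  add_mem' := by
    rintro f g ⟨ι, _, b, p, hb, hp, h⟩ ⟨ι', _, b', p', hb', hp', h'⟩
    refine ⟨ι ⊕ ι', inferInstance, Sum.elim b b', Sum.elim p p', ?_, ?_, fun t ht ξ => ?_⟩
    · rintro (k | k)
      exacts [hb k, hb' k]
    · rintro (k | k)
      exacts [hp k, hp' k]
    · simp [h t ht ξ, h' t ht ξ]
  mul_mem' := by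
    rintro f g ⟨ι, _, b, p, hb, hp, h⟩ ⟨ι', _, b', p', hb', hp', h'⟩
    refine ⟨ι × ι', inferInstance, fun k => b k.1 * b' k.2, fun k => p k.1 * p' k.2,
      fun k => (hb _).mul (hb' _), fun k => (hp _).mul (hp' _), fun t ht ξ => ?_⟩
    simp only [Pi.mul_apply, h t ht ξ, h' t ht ξ, Finset.sum_mul_sum, Fintype.sum_prod_type]
    exact Finset.sum_congr rfl fun i _ => Finset.sum_congr rfl fun j _ => by ring
  algebraMap_mem' r := ⟨Unit, inferInstance, fun _ _ => r, fun _ _ => 1,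
    fun _ => analyticOnNhd_const, fun _ => polyBdd_const 1, fun t ht ξ => by
      simp⟩

lemma mem_sepAlg {g : ℝ → E → ℝ} : g ∈ sepAlg E T ↔ SepSum T PolyBdd g := Iff.rfl

/-- This turns identities known only for `t ∈ (0,T)` into identities of functions, up to a
correction inside the ring. -/
lemma mem_sepAlg_of_eq_zero {g : ℝ → E → ℝ} (h : ∀ t ∈ Ioo 0 T, ∀ ξ, g t ξ = 0) :
    g ∈ sepAlg E T :=
  ⟨Empty, inferInstance, Empty.elim, Empty.elim, nofun, nofun, by simpa using h⟩

variable (E T) in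
/-- The fractions of elements of `sepAlg E T` with denominator bounded below by a positive
constant. -/
def fracAlg : Subalgebra ℝ (ℝ → E → ℝ) where
  carrier := {f | ∃ g ∈ sepAlg E T, ∃ u ∈ sepAlg E T, ∃ c : ℝ, 0 < c ∧
    ∀ t ∈ Ioo 0 T, ∀ ξ, c ≤ u t ξ ∧ f t ξ * u t ξ = g t ξ}
  add_mem' := by
    rintro f f' ⟨g, hg, u, hu, c, hc, h⟩ ⟨g', hg', u', hu', c', hc', h'⟩
    refine ⟨g * u' + g' * u, add_mem (mul_mem hg hu') (mul_mem hg' hu), u * u', mul_mem hu hu',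
      c * c', by positivity, fun t ht ξ => ⟨?_, ?_⟩⟩
    · exact mul_le_mul (h t ht ξ).1 (h' t ht ξ).1 hc'.le (hc.le.trans (h t ht ξ).1)
    · have h1 := (h t ht ξ).2
      have h2 := (h' t ht ξ).2
      simp only [Pi.add_apply, Pi.mul_apply]
      linear_combination u' t ξ * h1 + u t ξ * h2
  mul_mem' := by
    rintro f f' ⟨g, hg, u, hu, c, hc, h⟩ ⟨g', hg', u', hu', c', hc', h'⟩
    refine ⟨g * g', mul_mem hg hg', u * u', mul_mem hu hu',
      c * c', by positivity, fun t ht ξ => ⟨?_, ?_⟩⟩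
    · exact mul_le_mul (h t ht ξ).1 (h' t ht ξ).1 hc'.le (hc.le.trans (h t ht ξ).1)
    · have h1 := (h t ht ξ).2
      have h2 := (h' t ht ξ).2
      simp only [Pi.mul_apply]
      rw [← h1, ← h2]
      ring
  algebraMap_mem' r := ⟨_, algebraMap_mem _ r, 1, one_mem _, 1, one_pos, fun t ht ξ => by simp⟩

lemma sepAlg_le_fracAlg : sepAlg E T ≤ fracAlg E T :=
  fun g hg => ⟨g, hg, 1, one_mem _, 1, one_pos, fun t ht ξ => by simp⟩

lemma mem_fracAlg_of_mul_eq_one {f u : ℝ → E → ℝ} (hu : u ∈ sepAlg E T) {c : ℝ} (hc : 0 < c)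
    (h : ∀ t ∈ Ioo 0 T, ∀ ξ, c ≤ u t ξ ∧ f t ξ * u t ξ = 1) : f ∈ fracAlg E T :=
  ⟨1, one_mem _, u, hu, c, hc, h⟩

lemma analyticOnNhd_of_mem_fracAlg {f : ℝ → E → ℝ} (hf : f ∈ fracAlg E T) (ξ : E) :
    AnalyticOnNhd ℝ (fun t => f t ξ) (Ioo 0 T) := by
  obtain ⟨g, hg, u, hu, c, hc, h⟩ := hf
  have hu0 : ∀ t ∈ Ioo 0 T, u t ξ ≠ 0 := fun t ht => (hc.trans_le (h t ht ξ).1).ne'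
  refine AnalyticOnNhd.congr isOpen_Ioo (f := fun t => g t ξ / u t ξ)
    ((hg.analyticOnNhd ξ).div (hu.analyticOnNhd ξ) hu0) fun t ht => ?_
  simp only
  rw [← (h t ht ξ).2, mul_div_cancel_right₀ _ (hu0 t ht)]

lemma polyBddOn_of_mem_fracAlg {f : ℝ → E → ℝ} (hf : f ∈ fracAlg E T) :
    PolyBddOn (Ioo 0 T) f := by
  obtain ⟨g, hg, u, hu, c, hc, h⟩ := hf
  have hinv : PolyBddOn (Ioo 0 T) fun (_ : ℝ) (_ : E) => c⁻¹ :=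
    PolyBddOn.of_bounded (C := |c⁻¹|) (by simp)
  refine (hinv.mul (SepSum.polyBddOn hg)).mono fun t ht ξ => ?_
  obtain ⟨h1, h2⟩ := h t ht ξ
  have hu : |u t ξ| = u t ξ := abs_of_pos (hc.trans_le h1)
  rw [Pi.mul_apply, Pi.mul_apply, ← h2, abs_mul, abs_mul, hu, abs_of_pos (inv_pos.2 hc),
    inv_mul_eq_div, le_div_iff₀ hc]
  exact mul_le_mul_of_nonneg_left h1 (abs_nonneg _)

lemma exists_zeroBound_of_mem_fracAlg {f : ℝ → E → ℝ} (hf : f ∈ fracAlg E T) :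
    ∃ N, ∀ ξ, ZeroBound (Ioo 0 T) N fun t => f t ξ := by
  obtain ⟨g, hg, u, hu, c, hc, h⟩ := hf
  obtain ⟨N, hN⟩ := SepSum.exists_zeroBound hg
  refine ⟨N, fun ξ => (hN ξ).of_zero_imp fun t ht => ?_⟩
  rw [← (h t ht ξ).2, mul_eq_zero, or_iff_left (hc.trans_le (h t ht ξ).1).ne']

lemma exists_equation_of_isIntegral {g : ℝ → E → ℝ} (hg : IsIntegral (fracAlg E T) g) :
    ∃ (d : ℕ) (F : ℕ → ℝ → E → ℝ), (∀ i, F i ∈ fracAlg E T) ∧ F d = 1 ∧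
      ∀ t ξ, ∑ i ∈ Finset.range (d + 1), F i t ξ * g t ξ ^ i = 0 := by
  obtain ⟨p, hp, h⟩ := hg
  refine ⟨p.natDegree, fun i => (p.coeff i : ℝ → E → ℝ), fun i => (p.coeff i).2, ?_,
    fun t ξ => ?_⟩
  · have : p.coeff p.natDegree = 1 := hp
    simp [this]
  · rw [Polynomial.eval₂_eq_sum_range] at h
    have := congrFun (congrFun h t) ξ
    simpa [Finset.sum_apply] using this

/-- `g` is analytic in `t ∈ (0,T)` and integral over `fracAlg E T`. -/
def Tame (T : ℝ) (g : ℝ → E → ℝ) : Prop :=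
  (∀ ξ, AnalyticOnNhd ℝ (fun t => g t ξ) (Ioo 0 T)) ∧ IsIntegral (fracAlg E T) g

lemma tame_of_mem_fracAlg {g : ℝ → E → ℝ} (hg : g ∈ fracAlg E T) : Tame T g :=
  ⟨analyticOnNhd_of_mem_fracAlg hg, isIntegral_algebraMap (R := fracAlg E T) (A := ℝ → E → ℝ) (x := ⟨g, hg⟩)⟩

lemma Tame.add {f g : ℝ → E → ℝ} (hf : Tame T f) (hg : Tame T g) : Tame T (f + g) :=
  ⟨fun ξ => (hf.1 ξ).add (hg.1 ξ), hf.2.add hg.2⟩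

lemma Tame.mul {f g : ℝ → E → ℝ} (hf : Tame T f) (hg : Tame T g) : Tame T (f * g) :=
  ⟨fun ξ => (hf.1 ξ).mul (hg.1 ξ), hf.2.mul hg.2⟩

lemma isIntegral_congr {f g : ℝ → E → ℝ} (hf : IsIntegral (fracAlg E T) f)
    (h : ∀ t ∈ Ioo 0 T, ∀ ξ, g t ξ = f t ξ) : IsIntegral (fracAlg E T) g := by
  have : g - f ∈ fracAlg E T :=
    sepAlg_le_fracAlg (mem_sepAlg_of_eq_zero fun t ht ξ => sub_eq_zero.2 (h t ht ξ))
  simpa using (tame_of_mem_fracAlg this).2.add hf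

lemma Tame.congr {f g : ℝ → E → ℝ} (hf : Tame T f)
    (h : ∀ t ∈ Ioo 0 T, ∀ ξ, g t ξ = f t ξ) : Tame T g :=
  ⟨fun ξ => (hf.1 ξ).congr isOpen_Ioo fun t ht => (h t ht ξ).symm, isIntegral_congr hf.2 h⟩

/-- Cauchy's bound: a root of a monic polynomial is at most one plus the sum of the absolute values
of the lower coefficients, which are polynomially bounded. -/
lemma Tame.polyBddOn {g : ℝ → E → ℝ} (hg : Tame T g) : PolyBddOn (Ioo 0 T) g := by
  obtain ⟨d, F, hF, hd, h⟩ := exists_equation_of_isIntegral hg.2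
  have hS : PolyBddOn (Ioo 0 T) (1 + ∑ i ∈ Finset.range d, fun t ξ => |F i t ξ|) :=
    (PolyBddOn.of_bounded (C := 1) (by simp)).add (PolyBddOn.sum _ fun i _ =>
      (polyBddOn_of_mem_fracAlg (hF i)).mono fun t ht ξ => by simp)
  refine hS.mono fun t ht ξ => ?_
  simp only [Pi.add_apply, Pi.one_apply, Finset.sum_apply]
  have hnn : 0 ≤ ∑ i ∈ Finset.range d, |F i t ξ| := Finset.sum_nonneg fun i _ => abs_nonneg _
  rw [abs_of_nonneg (by positivity : 0 ≤ 1 + ∑ i ∈ Finset.range d, |F i t ξ|)]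
  by_contra! hlt
  set x := g t ξ
  have hx1 : 1 < |x| := by linarith
  have heq := h t ξ
  rw [Finset.sum_range_succ, hd] at heq
  have heq' : x ^ d = -∑ i ∈ Finset.range d, F i t ξ * x ^ i := by
    simp only [Pi.one_apply] at heq
    linarith
  rcases d with _ | d
  · simp at heq'
  have : |x| ^ (d + 1) ≤ (∑ i ∈ Finset.range (d + 1), |F i t ξ|) * |x| ^ d := by
    rw [← abs_pow, heq', abs_neg, Finset.sum_mul]
    refine (Finset.abs_sum_le_sum_abs _ _).trans (Finset.sum_le_sum fun i hi => ?_)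
    rw [abs_mul, abs_pow]
    gcongr
    · exact hx1.le
    · simpa [Nat.lt_succ_iff] using hi
  rw [pow_succ', mul_le_mul_iff_left₀ (by positivity)] at this
  linarith

/-- For fixed `ξ` let `F i₀` be the first coefficient not identically zero in `t`. The equation is
divisible by `g ^ i₀`; after cancellation, every zero of `g` is a zero of `F i₀`. -/
theorem Tame.exists_zeroBound {g : ℝ → E → ℝ} (hg : Tame T g) :
    ∃ N, ∀ ξ, ZeroBound (Ioo 0 T) N fun t => g t ξ := by
  obtain ⟨d, F, hF, hd, h⟩ := exists_equation_of_isIntegral hg.2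
  choose N hN using fun i => exists_zeroBound_of_mem_fracAlg (hF i)
  refine ⟨∑ i ∈ Finset.range (d + 1), N i, fun ξ => ?_⟩
  by_cases h0 : ∀ t ∈ Ioo 0 T, g t ξ = 0
  · exact Or.inl h0
  obtain ⟨t₀, ht₀, -⟩ : ∃ t ∈ Ioo 0 T, g t ξ ≠ 0 := by
    push Not at h0
    exact h0
  classical
  have hex : ∃ i, ¬ ∀ t ∈ Ioo 0 T, F i t ξ = 0 :=
    ⟨d, fun hall => by simpa [hd] using hall t₀ ht₀⟩
  set i₀ := Nat.find hex with hi₀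
  have hne := Nat.find_spec hex
  rw [← hi₀] at hne
  have hmin : ∀ i < i₀, ∀ t ∈ Ioo 0 T, F i t ξ = 0 := fun i hi => not_not.1 (Nat.find_min hex hi)
  have hle : i₀ ≤ d := Nat.find_min' hex fun hall => by simpa [hd] using hall t₀ ht₀
  obtain ⟨k, rfl⟩ := Nat.exists_eq_add_of_le hle
  have hprod : ∀ t ∈ Ioo 0 T,
      g t ξ ^ i₀ * ∑ i ∈ Finset.range (k + 1), F (i₀ + i) t ξ * g t ξ ^ i = 0 := by
    intro t ht
    have := h t ξ
    rw [add_assoc, Finset.sum_range_add, Finset.sum_eq_zero (fun i hi => by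
      rw [hmin i (Finset.mem_range.1 hi) t ht, zero_mul]), zero_add] at this
    rw [← this, Finset.mul_sum]
    exact Finset.sum_congr rfl fun i _ => by ring
  -- Analytic functions on an interval have no zero divisors, so the power of `g` cancels even at
  -- the zeros of `g`.
  have hsum := (AnalyticOnNhd.eq_zero_or_eq_zero_of_mul_eq_zero ((hg.1 ξ).pow i₀)
    (Finset.analyticOnNhd_fun_sum _ fun i _ =>
      (analyticOnNhd_of_mem_fracAlg (hF (i₀ + i)) ξ).mul ((hg.1 ξ).pow i)) hprod
      isPreconnected_Ioo).resolve_left fun hall => h0 fun t ht =>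
        eq_zero_of_pow_eq_zero (hall t ht)
  obtain ⟨Z, hZ, hZ'⟩ := (hN i₀ ξ).resolve_left hne
  -- Since `i₀` depends on `ξ`, the uniform bound is the sum over all coefficients.
  refine Or.inr ⟨Z, hZ.trans (Finset.single_le_sum (f := N) (fun i _ => Nat.zero_le _)
    (Finset.mem_range.2 (by omega))), fun t ht hgt => hZ' t ht ?_⟩
  have := hsum t ht
  rw [Finset.sum_range_succ'] at this
  simpa [hgt] using this

end ThirdOrder

/-! ### Total variation and logarithmic integral bounds. -/

namespace ThirdOrder

open Set Filter Topology

lemma nonneg_or_nonpos_of_ne_zero {f : ℝ → ℝ} {a b : ℝ} (hf : ContinuousOn f (Icc a b))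
    (h0 : ∀ t ∈ Ioo a b, f t ≠ 0) : (∀ t ∈ Icc a b, 0 ≤ f t) ∨ ∀ t ∈ Icc a b, f t ≤ 0 := by
  by_contra! h
  obtain ⟨⟨x, hx, hfx⟩, y, hy, hfy⟩ := h
  have hsub : uIcc x y ⊆ Icc a b := uIcc_subset_Icc hx hy
  obtain ⟨z, hz, hfz⟩ := intermediate_value_uIcc (hf.mono hsub)
    (mem_uIcc.2 (Or.inl ⟨hfx.le, hfy.le⟩))
  have hzx : z ≠ x := fun h => by rw [h] at hfz; linarith
  have hzy : z ≠ y := fun h => by rw [h] at hfz; linarith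
  refine h0 z ?_ hfz
  rcases mem_uIcc.1 hz with h | h
  · exact ⟨hx.1.trans_lt (lt_of_le_of_ne h.1 hzx.symm), (lt_of_le_of_ne h.2 hzy).trans_le hy.2⟩
  · exact ⟨hy.1.trans_lt (lt_of_le_of_ne h.1 hzy.symm), (lt_of_le_of_ne h.2 hzx).trans_le hx.2⟩

/-- A bound for the total variation of a bounded function in terms of the number of zeros of its
derivative. -/
theorem integral_abs_deriv_le {h h' : ℝ → ℝ} {K a b : ℝ} (hab : a ≤ b)
    (hd : ∀ t ∈ Icc a b, HasDerivAt h (h' t) t) (hc : ContinuousOn h' (Icc a b))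
    (hK : ∀ t ∈ Icc a b, |h t| ≤ K) (Z : Finset ℝ) (hZ : ∀ t ∈ Ioo a b, h' t = 0 → t ∈ Z) :
    ∫ t in a..b, |h' t| ≤ 2 * K * (Z.card + 1) := by
  have hK0 : 0 ≤ K := (abs_nonneg _).trans (hK a (left_mem_Icc.2 hab))
  induction hn : Z.card using Nat.strong_induction_on generalizing Z a b with
  | _ N ih =>
  subst hn
  -- Splitting at a zero removes it from both halves, so the two counts sum to at most `Z.card - 1`
  -- and the factors `card + 1` add up. Without a zero, `h'` has one sign and the integral is `|h b
  -- - h a|`.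
  by_cases hz : ∃ z ∈ Ioo a b, h' z = 0
  · obtain ⟨z, hz, hz0⟩ := hz
    have hzZ := hZ z hz hz0
    have hcard : (Z.filter (· < z)).card + (Z.filter (z < ·)).card + 1 ≤ Z.card := by
      rw [← Finset.card_union_of_disjoint (Finset.disjoint_left.2 fun x hx hx' => by
        simp only [Finset.mem_filter] at hx hx'
        exact lt_asymm hx.2 hx'.2), ← Finset.card_insert_of_notMem (a := z) (by simp)]
      refine Finset.card_le_card fun x hx => ?_
      simp only [Finset.mem_insert, Finset.mem_union, Finset.mem_filter] at hx
      rcases hx with rfl | hx | hx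
      exacts [hzZ, hx.1, hx.1]
    have hs1 : Icc a z ⊆ Icc a b := Icc_subset_Icc_right hz.2.le
    have hs2 : Icc z b ⊆ Icc a b := Icc_subset_Icc_left hz.1.le
    have h1 := ih _ (by omega) hz.1.le (fun t ht => hd t (hs1 ht)) (hc.mono hs1)
      (fun t ht => hK t (hs1 ht)) (Z.filter (· < z))
      (fun t ht h0 => Finset.mem_filter.2 ⟨hZ t ⟨ht.1, ht.2.trans hz.2⟩ h0, ht.2⟩) rfl
    have h2 := ih _ (by omega) hz.2.le (fun t ht => hd t (hs2 ht)) (hc.mono hs2)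
      (fun t ht => hK t (hs2 ht)) (Z.filter (z < ·))
      (fun t ht h0 => Finset.mem_filter.2 ⟨hZ t ⟨hz.1.trans ht.1, ht.2⟩ h0, ht.1⟩) rfl
    rw [← intervalIntegral.integral_add_adjacent_intervals (b := z)
      ((hc.mono hs1).abs.intervalIntegrable_of_Icc hz.1.le)
      ((hc.mono hs2).abs.intervalIntegrable_of_Icc hz.2.le)]
    have hcard' : ((Z.filter (· < z)).card : ℝ) + (Z.filter (z < ·)).card + 1 ≤ Z.card := by
      exact_mod_cast hcard
    nlinarith
  · push Not at hz
    have hint : ∫ t in a..b, h' t = h b - h a :=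
      intervalIntegral.integral_eq_sub_of_hasDerivAt
        (fun t ht => hd t (by rwa [uIcc_of_le hab] at ht)) (hc.intervalIntegrable_of_Icc hab)
    have hb1 := abs_le.1 (hK b (right_mem_Icc.2 hab))
    have ha1 := abs_le.1 (hK a (left_mem_Icc.2 hab))
    have hle : ∫ t in a..b, |h' t| ≤ 2 * K := by
      rcases nonneg_or_nonpos_of_ne_zero hc hz with hs | hs
      · rw [intervalIntegral.integral_congr (g := h') fun t ht =>
          abs_of_nonneg (hs t (by rwa [uIcc_of_le hab] at ht)), hint]
        linarith
      · rw [intervalIntegral.integral_congr (g := fun t => - h' t) fun t ht =>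
          abs_of_nonpos (hs t (by rwa [uIcc_of_le hab] at ht)),
          intervalIntegral.integral_neg, hint]
        linarith
    have : 0 ≤ 2 * K * (Z.card : ℝ) := by positivity
    linarith

/-- Two-sided `t`-derivatives are controlled only inside `(0,T)`; estimates on compact subintervals
pass to the limit by continuity of the primitive. -/
lemma intervalIntegral_le_of_forall_Icc {F : ℝ → ℝ} {T B : ℝ} (hT : 0 < T)
    (hF : IntervalIntegrable F volume 0 T)
    (h : ∀ a b, 0 < a → a ≤ b → b < T → ∫ t in a..b, F t ≤ B) : ∫ t in (0 : ℝ)..T, F t ≤ B := by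
  have hcont : ContinuousOn (fun x => ∫ t in (0 : ℝ)..x, F t) (Icc 0 T) := by
    have := intervalIntegral.continuousOn_primitive_interval' hF (left_mem_uIcc)
    rwa [uIcc_of_le hT.le] at this
  have hlim : Tendsto (fun ε => (∫ t in (0 : ℝ)..(T - ε), F t) - ∫ t in (0 : ℝ)..ε, F t)
      (𝓝[>] 0) (𝓝 ((∫ t in (0 : ℝ)..T, F t) - ∫ t in (0 : ℝ)..0, F t)) := by
    have hev : ∀ᶠ ε in 𝓝[>] (0 : ℝ), ε ∈ Ioo 0 T := Ioo_mem_nhdsGT hT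
    refine Tendsto.sub ?_ ?_
    · refine (hcont T (right_mem_Icc.2 hT.le)).tendsto.comp
        (tendsto_nhdsWithin_iff.2 ⟨?_, ?_⟩)
      · have : Tendsto (fun ε : ℝ => T - ε) (𝓝 0) (𝓝 (T - 0)) :=
          tendsto_const_nhds.sub tendsto_id
        rw [sub_zero] at this
        exact this.mono_left nhdsWithin_le_nhds
      · filter_upwards [hev] with ε hε
        exact ⟨by linarith [hε.2], by linarith [hε.1]⟩
    · refine (hcont 0 (left_mem_Icc.2 hT.le)).tendsto.comp
        (tendsto_nhdsWithin_iff.2 ⟨tendsto_id.mono_left nhdsWithin_le_nhds, ?_⟩)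
      filter_upwards [hev] with ε hε using Ioo_subset_Icc_self hε
  rw [intervalIntegral.integral_same, sub_zero] at hlim
  refine le_of_tendsto hlim ?_
  filter_upwards [Ioo_mem_nhdsGT (half_pos hT)] with ε hε
  have hsub : ∀ x ∈ Icc 0 T, IntervalIntegrable F volume 0 x := fun x hx =>
    hF.mono_set (by rw [uIcc_of_le hx.1, uIcc_of_le hT.le]; exact Icc_subset_Icc_right hx.2)
  rw [intervalIntegral.integral_interval_sub_left (hsub _ ⟨by linarith [hε.2], by linarith [hε.1]⟩)
    (hsub _ ⟨hε.1.le, by linarith [hε.2]⟩)]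
  exact h _ _ hε.1 (by linarith [hε.2]) (by linarith [hε.1])

/-- For `y ≥ 0`, `arsinh y = log (y + √(1 + y²))` and `√(1 + y²) ≤ 1 + y`; the negative case follows
by oddness. -/
lemma abs_arsinh_le {x K : ℝ} (h : |x| ≤ K) : |Real.arsinh x| ≤ Real.log (1 + 2 * K) := by
  have key : ∀ y : ℝ, 0 ≤ y → y ≤ K → Real.arsinh y ≤ Real.log (1 + 2 * K) := by
    intro y hy hyK
    have hs : √(1 + y ^ 2) ≤ 1 + y := Real.sqrt_le_iff.2 ⟨by linarith, by nlinarith⟩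
    exact Real.log_le_log (by positivity) (by linarith)
  rcases le_total 0 x with hx | hx
  · rw [abs_of_nonneg (Real.arsinh_nonneg_iff.2 hx)]
    exact key x hx ((le_abs_self x).trans h)
  · rw [abs_of_nonpos (Real.arsinh_nonpos_iff.2 hx), ← Real.arsinh_neg]
    exact key (-x) (by linarith) ((neg_le_abs x).trans h)

variable {E : Type*} {T : ℝ}

lemma dt_eq_of_eqOn {f g : ℝ → E → ℝ} (h : ∀ t ∈ Ioo 0 T, ∀ ξ, g t ξ = f t ξ) :
    ∀ t ∈ Ioo 0 T, ∀ ξ, dt g t ξ = dt f t ξ := by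
  intro t ht ξ
  refine Filter.EventuallyEq.deriv_eq ?_
  filter_upwards [isOpen_Ioo.mem_nhds ht] with s hs using h s hs ξ

variable [NormedAddCommGroup E]

/-- `g` and `∂ₜ g` are both tame. -/
def DTame (T : ℝ) (g : ℝ → E → ℝ) : Prop := Tame T g ∧ Tame T (dt g)

lemma Tame.hasDerivAt {g : ℝ → E → ℝ} (hg : Tame T g) {t : ℝ} (ht : t ∈ Ioo 0 T) (ξ : E) :
    HasDerivAt (fun s => g s ξ) (dt g t ξ) t :=
  (hg.1 ξ t ht).differentiableAt.hasDerivAt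

lemma DTame.congr {f g : ℝ → E → ℝ} (hf : DTame T f)
    (h : ∀ t ∈ Ioo 0 T, ∀ ξ, g t ξ = f t ξ) : DTame T g :=
  ⟨hf.1.congr h, hf.2.congr (dt_eq_of_eqOn h)⟩

lemma DTame.add {f g : ℝ → E → ℝ} (hf : DTame T f) (hg : DTame T g) : DTame T (f + g) :=
  ⟨hf.1.add hg.1, (hf.2.add hg.2).congr fun _ ht ξ =>
    ((hf.1.hasDerivAt ht ξ).add (hg.1.hasDerivAt ht ξ)).deriv⟩

lemma DTame.mul {f g : ℝ → E → ℝ} (hf : DTame T f) (hg : DTame T g) : DTame T (f * g) :=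
  ⟨hf.1.mul hg.1, ((hf.2.mul hg.1).add (hf.1.mul hg.2)).congr fun _ ht ξ =>
    ((hf.1.hasDerivAt ht ξ).mul (hg.1.hasDerivAt ht ξ)).deriv⟩

lemma SepSum.tame {g : ℝ → E → ℝ} (hg : SepSum T PolyBdd g) : Tame T g :=
  tame_of_mem_fracAlg (sepAlg_le_fracAlg hg)

lemma SepSum.dTame {g : ℝ → E → ℝ} (hg : SepSum T PolyBdd g) : DTame T g :=
  ⟨hg.tame, hg.dt.tame⟩

lemma sepSum_const (c : ℝ) : SepSum T PolyBdd fun (_ : ℝ) (_ : E) => c :=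
  (sepAlg E T).algebraMap_mem c

lemma Tame.const_mul {g : ℝ → E → ℝ} (hg : Tame T g) (c : ℝ) : Tame T fun t ξ => c * g t ξ :=
  (sepSum_const c).tame.mul hg

lemma DTame.const_mul {g : ℝ → E → ℝ} (hg : DTame T g) (c : ℝ) : DTame T fun t ξ => c * g t ξ :=
  (sepSum_const c).dTame.mul hg

lemma Tame.neg {g : ℝ → E → ℝ} (hg : Tame T g) : Tame T (-g) :=
  (hg.const_mul (-1)).congr fun t _ ξ => by simp

lemma Tame.sub {f g : ℝ → E → ℝ} (hf : Tame T f) (hg : Tame T g) : Tame T (f - g) := by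
  simpa [sub_eq_add_neg] using hf.add hg.neg

lemma DTame.neg {g : ℝ → E → ℝ} (hg : DTame T g) : DTame T (-g) :=
  (hg.const_mul (-1)).congr fun t _ ξ => by simp

lemma DTame.sub {f g : ℝ → E → ℝ} (hf : DTame T f) (hg : DTame T g) : DTame T (f - g) := by
  simpa [sub_eq_add_neg] using hf.add hg.neg

/-- `∫₀ᵀ |F(t,ξ)| dt ≲ log (2 + |ξ|)`, uniformly in `ξ`. -/
def LogBdd (T : ℝ) (F : ℝ → E → ℝ) : Prop :=
  (∀ ξ, IntervalIntegrable (fun t => F t ξ) volume 0 T) ∧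
  ∃ C : ℝ, 0 < C ∧ ∀ ξ, ∫ t in (0 : ℝ)..T, |F t ξ| ≤ C * Real.log (2 + ‖ξ‖)

/-- The shift by 2 keeps the logarithm at least `log 2`, so additive constants can be absorbed even
at `ξ = 0`. -/
lemma log_two_add_pos (ξ : E) : 0 < Real.log (2 + ‖ξ‖) :=
  Real.log_pos (by linarith [norm_nonneg ξ])

lemma intervalIntegrable_of_dominated {F G : ℝ → ℝ} (hT : 0 < T)
    (hF : ContinuousOn F (Ioo 0 T)) (hG : IntervalIntegrable G volume 0 T)
    (h : ∀ t ∈ Ioo 0 T, |F t| ≤ |G t|) : IntervalIntegrable F volume 0 T := by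
  rw [intervalIntegrable_iff_integrableOn_Ioo_of_le hT.le] at hG ⊢
  refine Integrable.mono hG (hF.aestronglyMeasurable measurableSet_Ioo) ?_
  filter_upwards [ae_restrict_mem measurableSet_Ioo] with t ht using h t ht

lemma integral_le_integral_of_le_Ioo {F G : ℝ → ℝ} (hT : 0 < T)
    (hF : IntervalIntegrable F volume 0 T) (hG : IntervalIntegrable G volume 0 T)
    (h : ∀ t ∈ Ioo 0 T, F t ≤ G t) : ∫ t in (0 : ℝ)..T, F t ≤ ∫ t in (0 : ℝ)..T, G t :=
  intervalIntegral.integral_mono_on_of_le_Ioo hT.le hF hG h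

lemma LogBdd.mono {F G : ℝ → E → ℝ} (hT : 0 < T) (hG : LogBdd T G)
    (hF : ∀ ξ, ContinuousOn (fun t => F t ξ) (Ioo 0 T))
    (h : ∀ t ∈ Ioo 0 T, ∀ ξ, |F t ξ| ≤ |G t ξ|) : LogBdd T F := by
  obtain ⟨hG, C, hC, hle⟩ := hG
  have hint := fun ξ => intervalIntegrable_of_dominated hT (hF ξ) (hG ξ) fun t ht => h t ht ξ
  exact ⟨hint, C, hC, fun ξ => (integral_le_integral_of_le_Ioo hT (hint ξ).abs (hG ξ).abs
    fun t ht => h t ht ξ).trans (hle ξ)⟩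

lemma LogBdd.add {F G : ℝ → E → ℝ} (hT : 0 < T) (hF : LogBdd T F) (hG : LogBdd T G) :
    LogBdd T (F + G) := by
  obtain ⟨hF, C, hC, hFle⟩ := hF
  obtain ⟨hG, D, hD, hGle⟩ := hG
  refine ⟨fun ξ => (hF ξ).add (hG ξ), C + D, by positivity, fun ξ => ?_⟩
  calc ∫ t in (0 : ℝ)..T, |(F + G) t ξ| ≤ ∫ t in (0 : ℝ)..T, (|F t ξ| + |G t ξ|) :=
        integral_le_integral_of_le_Ioo hT ((hF ξ).add (hG ξ)).abs ((hF ξ).abs.add (hG ξ).abs)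
          fun t _ => abs_add_le _ _
    _ = (∫ t in (0 : ℝ)..T, |F t ξ|) + ∫ t in (0 : ℝ)..T, |G t ξ| :=
        intervalIntegral.integral_add (hF ξ).abs (hG ξ).abs
    _ ≤ _ := by rw [add_mul]; exact add_le_add (hFle ξ) (hGle ξ)

lemma LogBdd.sum (hT : 0 < T) {ι : Type*} (S : Finset ι) {F : ι → ℝ → E → ℝ}
    (hF : ∀ i ∈ S, LogBdd T (F i)) : LogBdd T (∑ i ∈ S, F i) :=
  Finset.sum_induction F (LogBdd T) (fun _ _ => LogBdd.add hT)
    ⟨fun ξ => by simp, 1, one_pos, fun ξ => by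
      simpa using (log_two_add_pos ξ).le⟩ hF

lemma LogBdd.const_mul {F : ℝ → E → ℝ} (hF : LogBdd T F) {c : ℝ} (hc : 0 < c) :
    LogBdd T fun t ξ => c * F t ξ := by
  obtain ⟨hF, C, hC, hFle⟩ := hF
  refine ⟨fun ξ => (hF ξ).const_mul c, c * C, by positivity, fun ξ => ?_⟩
  simp only [abs_mul, abs_of_pos hc, intervalIntegral.integral_const_mul, mul_assoc]
  exact mul_le_mul_of_nonneg_left (hFle ξ) hc.le

/-- As `√(1 + g²) ≤ |g| + 1`, the integrand is dominated by `|∂ₜ arsinh g|`, whose integral is a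
total variation. The zeros of this derivative are those of `∂ₜg`, and `arsinh` turns polynomial
growth into logarithmic growth. -/
theorem DTame.logBdd (hT : 0 < T) {g : ℝ → E → ℝ} (hg : DTame T g) :
    LogBdd T fun t ξ => |dt g t ξ| / (|g t ξ| + 1) := by
  obtain ⟨C, m, hC, hCm⟩ := hg.1.polyBddOn
  obtain ⟨D, k, hD, hDk⟩ := hg.2.polyBddOn
  obtain ⟨N, hN⟩ := hg.2.exists_zeroBound
  have hgc : ∀ ξ, ContinuousOn (fun t => g t ξ) (Ioo 0 T) := fun ξ => (hg.1.1 ξ).continuousOn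
  have hg'c : ∀ ξ, ContinuousOn (fun t => dt g t ξ) (Ioo 0 T) := fun ξ => (hg.2.1 ξ).continuousOn
  have hcont : ∀ ξ, ContinuousOn (fun t => |dt g t ξ| / (|g t ξ| + 1)) (Ioo 0 T) := fun ξ =>
    (hg'c ξ).abs.div ((hgc ξ).abs.add continuousOn_const) fun t _ => by positivity
  have hint : ∀ ξ, IntervalIntegrable (fun t => |dt g t ξ| / (|g t ξ| + 1)) volume 0 T := fun ξ =>
    intervalIntegrable_of_dominated hT (hcont ξ)
      (intervalIntegrable_const (c := D * (1 + ‖ξ‖) ^ k)) fun t ht => by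
        rw [abs_div, abs_abs, abs_of_pos (show 0 < |g t ξ| + 1 by positivity),
          abs_of_nonneg (show 0 ≤ D * (1 + ‖ξ‖) ^ k by positivity)]
        exact (div_le_self (abs_nonneg _) (by linarith [abs_nonneg (g t ξ)])).trans (hDk t ht ξ)
  -- The factor `2 * (N + 1)` is the variation bound; the rest compares `log (1 + 2C(1 + ‖ξ‖)^m)`
  -- with `log (2 + ‖ξ‖)`. Taking `m + 1` instead of `m` keeps the constant positive when `C = 0`
  -- and `m = 0`.
  refine ⟨hint, 2 * (N + 1) * (Real.log (1 + 2 * C) / Real.log 2 + (m + 1)), ?_, fun ξ => ?_⟩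
  · have : 0 ≤ Real.log (1 + 2 * C) := Real.log_nonneg (by linarith)
    have : 0 < Real.log 2 := Real.log_pos one_lt_two
    positivity
  set K := Real.log (1 + 2 * (C * (1 + ‖ξ‖) ^ m)) with hK
  have hK0 : 0 ≤ K := Real.log_nonneg (by linarith [show 0 ≤ C * (1 + ‖ξ‖) ^ m by positivity])
  have hmain : ∫ t in (0 : ℝ)..T, |(|dt g t ξ| / (|g t ξ| + 1))| ≤ 2 * K * (N + 1) := by
    rcases hN ξ with h0 | ⟨Z, hZ, hZ0⟩
    · refine (integral_le_integral_of_le_Ioo hT (hint ξ).abs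
        (intervalIntegrable_const (c := (0 : ℝ))) fun t ht => ?_).trans ?_
      · simp only at h0
        simp [h0 t ht]
      · simp only [intervalIntegral.integral_zero]
        positivity
    refine intervalIntegral_le_of_forall_Icc hT (hint ξ).abs fun a b ha hab hb => ?_
    have hsub : Icc a b ⊆ Ioo 0 T := fun t ht => ⟨ha.trans_le ht.1, ht.2.trans_lt hb⟩
    have hda : ∀ t ∈ Icc a b, HasDerivAt (fun s => Real.arsinh (g s ξ))
        ((√(1 + g t ξ ^ 2))⁻¹ * dt g t ξ) t := fun t ht =>
      (hg.1.hasDerivAt (hsub ht) ξ).arsinh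
    have hca : ContinuousOn (fun t => (√(1 + g t ξ ^ 2))⁻¹ * dt g t ξ) (Icc a b) := by
      refine ContinuousOn.mul (ContinuousOn.inv₀ ?_ fun t _ => by positivity)
        ((hg'c ξ).mono hsub)
      exact (continuousOn_const.add (((hgc ξ).mono hsub).pow 2)).sqrt
    calc ∫ t in a..b, |(|dt g t ξ| / (|g t ξ| + 1))|
        ≤ ∫ t in a..b, |(√(1 + g t ξ ^ 2))⁻¹ * dt g t ξ| := by
          refine intervalIntegral.integral_mono_on hab
            (((hcont ξ).mono hsub).abs.intervalIntegrable_of_Icc hab)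
            (hca.abs.intervalIntegrable_of_Icc hab) fun t ht => ?_
          rw [abs_div, abs_abs, abs_of_pos (show 0 < |g t ξ| + 1 by positivity), abs_mul,
            abs_of_pos (show 0 < (√(1 + g t ξ ^ 2))⁻¹ by positivity), div_eq_inv_mul]
          gcongr
          refine Real.sqrt_le_iff.2 ⟨by positivity, ?_⟩
          nlinarith [sq_abs (g t ξ), abs_nonneg (g t ξ)]
      _ ≤ 2 * K * (Z.card + 1) := integral_abs_deriv_le hab hda hca
          (fun t ht => abs_arsinh_le (hCm t (hsub ht) ξ)) Z fun t ht h0 =>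
            hZ0 t (hsub (Ioo_subset_Icc_self ht)) (by
              have : (√(1 + g t ξ ^ 2))⁻¹ ≠ 0 := by positivity
              simpa [this] using h0)
      _ ≤ 2 * K * (N + 1) := by gcongr
  have hξ : 0 ≤ ‖ξ‖ := norm_nonneg ξ
  have hKle : K ≤ (Real.log (1 + 2 * C) / Real.log 2 + (m + 1)) * Real.log (2 + ‖ξ‖) := by
    have hlog2 : 0 < Real.log 2 := Real.log_pos one_lt_two
    have h1 : K ≤ Real.log ((1 + 2 * C) * (1 + ‖ξ‖) ^ m) := by
      refine Real.log_le_log (by positivity) ?_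
      have : 1 ≤ (1 + ‖ξ‖) ^ m := one_le_pow₀ (by linarith)
      nlinarith
    rw [Real.log_mul (by positivity) (by positivity), Real.log_pow] at h1
    have h2 : Real.log (1 + ‖ξ‖) ≤ Real.log (2 + ‖ξ‖) :=
      Real.log_le_log (by linarith) (by linarith)
    have h3 : Real.log 2 ≤ Real.log (2 + ‖ξ‖) := Real.log_le_log (by norm_num) (by linarith)
    have h4 : Real.log (1 + 2 * C) ≤ Real.log (1 + 2 * C) / Real.log 2 * Real.log (2 + ‖ξ‖) := by
      rw [div_mul_eq_mul_div, le_div_iff₀ hlog2]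
      exact mul_le_mul_of_nonneg_left h3 (Real.log_nonneg (by linarith))
    have h5 : (m : ℝ) * Real.log (1 + ‖ξ‖) ≤ (m + 1) * Real.log (2 + ‖ξ‖) := by
      have := log_two_add_pos ξ
      nlinarith [(Nat.cast_nonneg m : (0 : ℝ) ≤ m)]
    linarith
  calc _ ≤ 2 * K * (N + 1) := hmain
    _ ≤ 2 * ((Real.log (1 + 2 * C) / Real.log 2 + (m + 1)) * Real.log (2 + ‖ξ‖)) * (N + 1) := by
        gcongr
    _ = _ := by ring

/-- The derivative of a complex-valued function with respect to the first variable. -/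
noncomputable def dtc (h : ℝ → E → ℂ) (t : ℝ) (ξ : E) : ℂ := deriv (fun s => h s ξ) t

/-- The real and the imaginary part of `h`, and their derivatives, are tame. -/
def CTame (T : ℝ) (h : ℝ → E → ℂ) : Prop :=
  DTame T (fun t ξ => (h t ξ).re) ∧ DTame T (fun t ξ => (h t ξ).im)

lemma CTame.congr {f g : ℝ → E → ℂ} (hf : CTame T f)
    (h : ∀ t ∈ Ioo 0 T, ∀ ξ, g t ξ = f t ξ) : CTame T g :=
  ⟨hf.1.congr fun t ht ξ => by rw [h t ht ξ], hf.2.congr fun t ht ξ => by rw [h t ht ξ]⟩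

lemma CTame.add {f g : ℝ → E → ℂ} (hf : CTame T f) (hg : CTame T g) :
    CTame T fun t ξ => f t ξ + g t ξ :=
  ⟨(hf.1.add hg.1).congr fun t _ ξ => by simp, (hf.2.add hg.2).congr fun t _ ξ => by simp⟩

lemma CTame.mul {f g : ℝ → E → ℂ} (hf : CTame T f) (hg : CTame T g) :
    CTame T fun t ξ => f t ξ * g t ξ :=
  ⟨((hf.1.mul hg.1).sub (hf.2.mul hg.2)).congr fun t _ ξ => by simp,
    ((hf.1.mul hg.2).add (hf.2.mul hg.1)).congr fun t _ ξ => by simp⟩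

lemma DTame.ofReal {f : ℝ → E → ℝ} (hf : DTame T f) : CTame T fun t ξ => (f t ξ : ℂ) :=
  ⟨by simpa using hf, by simpa using (sepSum_const (0 : ℝ)).dTame⟩

lemma CTame.const_mul {f : ℝ → E → ℂ} (hf : CTame T f) (c : ℝ) :
    CTame T fun t ξ => (c : ℂ) * f t ξ :=
  (sepSum_const c).dTame.ofReal.mul hf

lemma CTame.dtc_eq {h : ℝ → E → ℂ} (hh : CTame T h) {t : ℝ} (ht : t ∈ Ioo 0 T) (ξ : E) :
    dtc h t ξ = dt (fun t ξ => (h t ξ).re) t ξ + dt (fun t ξ => (h t ξ).im) t ξ * Complex.I := by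
  have := (hh.1.1.hasDerivAt ht ξ).ofReal_comp.add
    ((hh.2.1.hasDerivAt ht ξ).ofReal_comp.mul_const Complex.I)
  have heq : (fun s => h s ξ) = fun s => ((h s ξ).re : ℂ) + (h s ξ).im * Complex.I := by
    simp [Complex.re_add_im]
  rw [dtc, heq]
  exact this.deriv

/-- Reduction to the real case: `|h'| ≤ |Re h'| + |Im h'|`, while `|h|` dominates both `|Re h|` and
`|Im h|` in the denominator. -/
theorem CTame.logBdd (hT : 0 < T) {h : ℝ → E → ℂ} (hh : CTame T h) :
    LogBdd T fun t ξ => ‖deriv (fun s => h s ξ) t‖ / (‖h t ξ‖ + 1) := by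
  have hcont : ∀ ξ, ContinuousOn (fun t => h t ξ) (Ioo 0 T) := fun ξ => by
    have : ContinuousOn (fun t => ((h t ξ).re : ℂ) + (h t ξ).im * Complex.I) (Ioo 0 T) :=
      (Complex.continuous_ofReal.comp_continuousOn (hh.1.1.1 ξ).continuousOn).add
        ((Complex.continuous_ofReal.comp_continuousOn (hh.2.1.1 ξ).continuousOn).mul
          continuousOn_const)
    simpa [Complex.re_add_im] using this
  have hcont' : ∀ ξ, ContinuousOn (fun t => dtc h t ξ) (Ioo 0 T) := fun ξ =>
    ContinuousOn.congr ((Complex.continuous_ofReal.comp_continuousOn (hh.1.2.1 ξ).continuousOn).add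
        ((Complex.continuous_ofReal.comp_continuousOn (hh.2.2.1 ξ).continuousOn).mul
          continuousOn_const)) fun t ht => hh.dtc_eq ht ξ
  refine ((hh.1.logBdd hT).add hT (hh.2.logBdd hT)).mono hT
    (fun ξ => (hcont' ξ).norm.div ((hcont ξ).norm.add continuousOn_const)
      fun t _ => by positivity) fun t ht ξ => ?_
  simp only [Pi.add_apply]
  rw [abs_of_nonneg (by positivity), abs_of_nonneg (by positivity), ← dtc, hh.dtc_eq ht ξ]
  set u := dt (fun t ξ => (h t ξ).re) t ξ
  set v := dt (fun t ξ => (h t ξ).im) t ξ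
  calc ‖(u : ℂ) + v * Complex.I‖ / (‖h t ξ‖ + 1) ≤ (|u| + |v|) / (‖h t ξ‖ + 1) := by
        gcongr
        refine (norm_add_le _ _).trans (by simp)
    _ = |u| / (‖h t ξ‖ + 1) + |v| / (‖h t ξ‖ + 1) := add_div _ _ _
    _ ≤ _ := by
        gcongr
        · exact Complex.abs_re_le_norm _
        · exact Complex.abs_im_le_norm _

end ThirdOrder

/-! ### Ordered roots of real-rooted polynomials. -/

namespace ThirdOrder

section Roots

open Polynomial

/-- A polynomial with only real roots is the product of the linear factors belonging to its ordered
roots. -/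
lemma eq_prod_orderedRoot {p : ℂ[X]} (hr : ∀ z, p.eval z = 0 → z.im = 0) {d : ℕ}
    (hd : p.natDegree = d) :
    p = C p.leadingCoeff * ∏ j : Fin d, (X - C (orderedRoot p j : ℂ)) := by
  rcases eq_or_ne p 0 with rfl | hp
  · simp
  set l := (p.roots.map Complex.re).sort (· ≤ ·) with hl
  have hcard : Multiset.card p.roots = p.natDegree :=
    splits_iff_card_roots.1 (IsAlgClosed.splits p)
  have hlen : l.length = d := by rw [hl, Multiset.length_sort, Multiset.card_map, hcard, hd]
  have hlroots : ((l.map ((↑) : ℝ → ℂ) : List ℂ) : Multiset ℂ) = p.roots := by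
    rw [← Multiset.map_coe, hl, Multiset.sort_eq, Multiset.map_map]
    conv_rhs => rw [← Multiset.map_id p.roots]
    refine Multiset.map_congr rfl fun z hz => ?_
    exact Complex.ext (by simp) (by simp [hr z ((mem_roots hp).1 hz)])
  subst hlen
  have hprod : ∏ j : Fin l.length, (X - C (orderedRoot p j : ℂ)) =
      (p.roots.map fun z => X - C z).prod := by
    rw [← hlroots, Multiset.map_coe, Multiset.prod_coe, List.map_map]
    rw [← List.prod_ofFn]
    congr 1
    refine List.ext_getElem (by simp) fun i h1 h2 => ?_
    have hi : i < l.length := by simpa using h1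
    simp [orderedRoot, ← hl]
  rw [hprod]
  exact (C_leadingCoeff_mul_prod_multiset_X_sub_C hcard).symm

lemma orderedRoot_le {p : ℂ[X]} {i j d : ℕ} (hd : p.natDegree = d) (hij : i ≤ j) (hj : j < d) :
    orderedRoot p i ≤ orderedRoot p j := by
  set l := (p.roots.map Complex.re).sort (· ≤ ·) with hl
  have hcard : Multiset.card p.roots = p.natDegree :=
    splits_iff_card_roots.1 (IsAlgClosed.splits p)
  have hlen : l.length = d := by rw [hl, Multiset.length_sort, Multiset.card_map, hcard, hd]
  have hsorted : l.Pairwise (· ≤ ·) := Multiset.pairwise_sort _ _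
  have hj' : j < l.length := by omega
  have hi' : i < l.length := by omega
  rcases hij.eq_or_lt with rfl | hlt
  · rfl
  have := List.pairwise_iff_getElem.1 hsorted i j hi' hj' hlt
  simpa [orderedRoot, ← hl, List.getElem?_eq_getElem hi', List.getElem?_eq_getElem hj'] using this

end Roots

/-! ### Real-rootedness and root gaps of `L - L''`. -/

section RealCubics

/-- A cubic `u³ - P u - q` with positive discriminant has no root `u + i y` with `y ≠ 0`. -/
lemma depressed_im_eq_zero {p q u y : ℝ} (hp : 0 ≤ p) (hq : 27 * q ^ 2 ≤ 4 * p ^ 3)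
    (hre : u ^ 3 - 3 * u * y ^ 2 - (p + 6) * u - q = 0)
    (him : y * (3 * u ^ 2 - y ^ 2 - (p + 6)) = 0) : y = 0 := by
  by_contra hy
  have hy2 : y ^ 2 = 3 * u ^ 2 - (p + 6) := by
    have := (mul_eq_zero.1 him).resolve_left hy
    linarith
  set P := p + 6 with hP
  have hPpos : 0 < P := by positivity
  have hq' : q = 2 * u * (P - 4 * u ^ 2) := by
    rw [hy2] at hre
    linarith
  -- From `y² ≥ 0` one gets `u² ≥ P/3`, and then `27 q² = 108 u² (4u² - P)² ≥ 4 P³ > 4 p³`, a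
  -- contradiction.
  have hw : P / 3 ≤ u ^ 2 := by nlinarith [sq_nonneg y]
  have h1 : P / 3 ≤ 4 * u ^ 2 - P := by linarith
  have h2 : (P / 3) ^ 2 ≤ (4 * u ^ 2 - P) ^ 2 := by gcongr
  have h3 : (P / 3) * (P / 3) ^ 2 ≤ u ^ 2 * (4 * u ^ 2 - P) ^ 2 := by gcongr
  have h4 : q ^ 2 = 4 * (u ^ 2 * (4 * u ^ 2 - P) ^ 2) := by rw [hq']; ring
  have h5 : p ^ 3 < P ^ 3 := by gcongr; linarith
  nlinarith

/-- The discriminant `4p³ - 27q²` of a depressed cubic is the square of the product of the root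
differences. -/
lemma disc_le {l₀ l₁ l₂ : ℝ} (h : l₀ + l₁ + l₂ = 0) :
    0 ≤ -(l₀ * l₁ + l₀ * l₂ + l₁ * l₂) ∧
    27 * (l₀ * l₁ * l₂) ^ 2 ≤ 4 * (-(l₀ * l₁ + l₀ * l₂ + l₁ * l₂)) ^ 3 := by
  obtain rfl : l₂ = -l₀ - l₁ := by linarith
  constructor
  · nlinarith [sq_nonneg (l₀ + l₁), sq_nonneg l₀, sq_nonneg l₁]
  · nlinarith [sq_nonneg ((l₀ - l₁) * (2 * l₀ + l₁) * (l₀ + 2 * l₁))]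

/-- Translation by the mean of the roots depresses `L`; there `L'' = 6u`, so passing to `L - L''`
replaces `p` by `p + 6` and keeps `q`. -/
lemma im_eq_zero_of_cubic {l₀ l₁ l₂ b c d x y : ℝ} (hb : b = -(l₀ + l₁ + l₂))
    (hc : c = l₀ * l₁ + l₀ * l₂ + l₁ * l₂) (hd : d = -(l₀ * l₁ * l₂))
    (hre : x ^ 3 - 3 * x * y ^ 2 + b * (x ^ 2 - y ^ 2) + (c - 6) * x + (d - 2 * b) = 0)
    (him : 3 * x ^ 2 * y - y ^ 3 + 2 * b * x * y + (c - 6) * y = 0) : y = 0 := by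
  set s := (l₀ + l₁ + l₂) / 3 with hs
  obtain ⟨hp, hq⟩ := disc_le (l₀ := l₀ - s) (l₁ := l₁ - s) (l₂ := l₂ - s) (by rw [hs]; ring)
  refine depressed_im_eq_zero hp hq (u := x - s) ?_ ?_
  · rw [← hre, hb, hc, hd, hs]
    ring
  · rw [← him, hb, hc, hs]
    ring

/-- By the inequality of means `B * D ≤ (3P)²`, hence `A ≥ 24 / 9`. -/
lemma sq_ge_of_mul_ge {A B D P : ℝ} (hA : 0 ≤ A) (hB : 0 ≤ B) (hD : 0 ≤ D) (hP : 0 < P)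
    (hsum : A + B + D = 6 * P) (hprod : 24 * P ^ 2 ≤ A * B * D) : 8 / 3 ≤ A := by
  by_contra! hlt
  have h1 : B + D ≤ 6 * P := by linarith
  have h2 : B * D ≤ 9 * P ^ 2 := by nlinarith [sq_nonneg (B - D)]
  have h3 : 0 ≤ B * D := by positivity
  have h4 : 0 < P ^ 2 := by positivity
  rcases h3.eq_or_lt with h | h
  · rw [mul_assoc, ← h] at hprod
    nlinarith
  · nlinarith

lemma depressed_gap_bounds {p q u v w : ℝ} (hp : 0 ≤ p) (hq : 27 * q ^ 2 ≤ 4 * p ^ 3)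
    (h1 : u + v + w = 0) (h2 : u * v + u * w + v * w = -(p + 6)) (h3 : u * v * w = q) :
    8 / 3 ≤ (u - v) ^ 2 ∧ 8 / 3 ≤ (v - w) ^ 2 ∧ 8 / 3 ≤ (w - u) ^ 2 ∧
      864 ≤ (u - v) ^ 2 * (v - w) ^ 2 * (w - u) ^ 2 := by
  obtain ⟨P, rfl⟩ : ∃ P, p = P - 6 := ⟨p + 6, by ring⟩
  have hP : 6 ≤ P := by linarith
  have hsum : (u - v) ^ 2 + (v - w) ^ 2 + (w - u) ^ 2 = 6 * P := by
    linear_combination 2 * (u + v + w) * h1 - 6 * h2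
  have hprod : (u - v) ^ 2 * (v - w) ^ 2 * (w - u) ^ 2 = 4 * P ^ 3 - 27 * q ^ 2 := by
    obtain rfl : w = -u - v := by linarith
    obtain rfl : P = u ^ 2 + u * v + v ^ 2 := by linarith
    rw [← h3]
    ring
  -- The discriminant is at least `4(P³ - (P-6)³) = 24P² + 48(P-3)(P-6)`, and `P ≥ 6`.
  have hge : 24 * P ^ 2 ≤ (u - v) ^ 2 * (v - w) ^ 2 * (w - u) ^ 2 := by
    have h4 : 0 ≤ (P - 3) * (P - 6) := mul_nonneg (by linarith) (by linarith)
    rw [hprod]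
    linarith
  have hP0 : 0 < P := by linarith
  have h864 : 864 ≤ 24 * P ^ 2 := by
    have : (6 : ℝ) ^ 2 ≤ P ^ 2 := by gcongr
    linarith
  exact ⟨sq_ge_of_mul_ge (sq_nonneg _) (sq_nonneg _) (sq_nonneg _) hP0 hsum hge,
    sq_ge_of_mul_ge (sq_nonneg _) (sq_nonneg (w - u)) (sq_nonneg (u - v)) hP0
      (by rw [← hsum]; ring) (hge.trans_eq (by ring)),
    sq_ge_of_mul_ge (sq_nonneg _) (sq_nonneg (u - v)) (sq_nonneg (v - w)) hP0
      (by rw [← hsum]; ring) (hge.trans_eq (by ring)), h864.trans hge⟩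

/-- If `x₀, x₁, x₂` are the roots of `L - L''`, where `L` is a monic cubic with the real roots
`l₀, l₁, l₂`, then the discriminant of `L - L''` and the gaps of its roots are bounded below. -/
lemma gap_bounds {l₀ l₁ l₂ x₀ x₁ x₂ : ℝ} (h1 : x₀ + x₁ + x₂ = l₀ + l₁ + l₂)
    (h2 : x₀ * x₁ + x₀ * x₂ + x₁ * x₂ = l₀ * l₁ + l₀ * l₂ + l₁ * l₂ - 6)
    (h3 : x₀ * x₁ * x₂ = l₀ * l₁ * l₂ - 2 * (l₀ + l₁ + l₂)) :
    8 / 3 ≤ (x₀ - x₁) ^ 2 ∧ 8 / 3 ≤ (x₁ - x₂) ^ 2 ∧ 8 / 3 ≤ (x₂ - x₀) ^ 2 ∧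
      864 ≤ (x₀ - x₁) ^ 2 * (x₁ - x₂) ^ 2 * (x₂ - x₀) ^ 2 := by
  obtain ⟨s, hs⟩ : ∃ s, l₀ + l₁ + l₂ = 3 * s := ⟨(l₀ + l₁ + l₂) / 3, by ring⟩
  obtain ⟨hp, hq⟩ := disc_le (l₀ := l₀ - s) (l₁ := l₁ - s) (l₂ := l₂ - s) (by linarith)
  have := depressed_gap_bounds (u := x₀ - s) (v := x₁ - s) (w := x₂ - s) hp hq (by linarith)
    (by linear_combination h2 - 2 * s * h1)
    (by linear_combination h3 - s * h2 + s ^ 2 * h1 - 2 * hs)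
  simpa only [sub_sub_sub_cancel_right] using this

end RealCubics

/-! ### Factorization of the auxiliary polynomial and its derivative. -/

section Symbols

open Polynomial

variable {n : ℕ} {a : Coeffs n} {T t : ℝ} {ξ : EuclideanSpace ℝ (Fin n)}

lemma symL_eq (a : Coeffs n) (t : ℝ) (ξ : EuclideanSpace ℝ (Fin n)) :
    symL a t ξ = X ^ 3 + C (coeffSum a 2 1 t ξ) * X ^ 2 + C (coeffSum a 1 2 t ξ) * X +
      C (coeffSum a 0 3 t ξ) := by
  simp only [symL, Finset.sum_range_succ, Finset.range_zero, Finset.sum_empty]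
  norm_num
  ring

lemma auxL_eq (a : Coeffs n) (t : ℝ) (ξ : EuclideanSpace ℝ (Fin n)) :
    auxL a t ξ = X ^ 3 + C (coeffSum a 2 1 t ξ) * X ^ 2 + C (coeffSum a 1 2 t ξ - 6) * X +
      C (coeffSum a 0 3 t ξ - 2 * coeffSum a 2 1 t ξ) := by
  rw [auxL, symL_eq]
  simp only [derivative_add, derivative_X_pow, derivative_mul, derivative_C, derivative_X, map_sub,
    map_mul, zero_mul, zero_add, map_natCast, derivative_natCast, derivative_one, map_ofNat]
  norm_num
  ring

lemma derivative_auxL_eq (a : Coeffs n) (t : ℝ) (ξ : EuclideanSpace ℝ (Fin n)) :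
    derivative (auxL a t ξ) = C 3 * X ^ 2 + C (2 * coeffSum a 2 1 t ξ) * X +
      C (coeffSum a 1 2 t ξ - 6) := by
  rw [auxL_eq]
  simp only [derivative_add, derivative_X_pow, derivative_mul, derivative_C, derivative_X, map_sub,
    map_mul, zero_mul, zero_add, map_natCast, map_ofNat]
  norm_num
  ring

/-- The real part of the coefficient of `τ^j` in the principal symbol. -/
noncomputable def cf (a : Coeffs n) (j : ℕ) (t : ℝ) (ξ : EuclideanSpace ℝ (Fin n)) : ℝ :=
  (coeffSum a j (3 - j) t ξ).re

lemma monic_cubic (b c d : ℂ) : (X ^ 3 + C b * X ^ 2 + C c * X + C d : ℂ[X]).Monic ∧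
    (X ^ 3 + C b * X ^ 2 + C c * X + C d : ℂ[X]).natDegree = 3 := by
  constructor
  · monicity!
  · compute_degree!

lemma vieta_cubic {b c d x y z : ℂ}
    (h : (X ^ 3 + C b * X ^ 2 + C c * X + C d : ℂ[X]) = (X - C x) * (X - C y) * (X - C z)) :
    b = -(x + y + z) ∧ c = x * y + x * z + y * z ∧ d = -(x * y * z) := by
  have h0 := congrArg (eval 0) h
  have h1 := congrArg (eval 1) h
  have h2 := congrArg (eval (-1)) h
  simp only [eval_add, eval_mul, eval_pow, eval_X, eval_C, eval_sub] at h0 h1 h2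
  refine ⟨?_, ?_, ?_⟩
  · linear_combination (h1 + h2) / 2 - h0
  · linear_combination (h1 - h2) / 2
  · linear_combination h0

/-- Where `L` has only real roots, it has real coefficients, given by its roots. -/
lemma exists_roots_symL (hL : WeaklyHyperbolic a T) (ht : t ∈ Set.Icc 0 T)
    (ξ : EuclideanSpace ℝ (Fin n)) :
    (coeffSum a 2 1 t ξ = cf a 2 t ξ ∧ coeffSum a 1 2 t ξ = cf a 1 t ξ ∧
      coeffSum a 0 3 t ξ = cf a 0 t ξ) ∧
    ∃ l₀ l₁ l₂ : ℝ, cf a 2 t ξ = -(l₀ + l₁ + l₂) ∧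
      cf a 1 t ξ = l₀ * l₁ + l₀ * l₂ + l₁ * l₂ ∧ cf a 0 t ξ = -(l₀ * l₁ * l₂) := by
  have hmon := monic_cubic (coeffSum a 2 1 t ξ) (coeffSum a 1 2 t ξ) (coeffSum a 0 3 t ξ)
  rw [← symL_eq] at hmon
  have h := eq_prod_orderedRoot (hL t ht ξ) hmon.2
  rw [hmon.1.leadingCoeff, map_one, one_mul, Fin.prod_univ_three] at h
  set l := orderedRoot (symL a t ξ)
  rw [symL_eq] at h
  obtain ⟨hb, hc, hd⟩ := vieta_cubic h
  have hb' : coeffSum a 2 1 t ξ = ((-(l 0 + l 1 + l 2) : ℝ) : ℂ) := by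
    rw [hb]; push_cast; rfl
  have hc' : coeffSum a 1 2 t ξ = ((l 0 * l 1 + l 0 * l 2 + l 1 * l 2 : ℝ) : ℂ) := by
    rw [hc]; push_cast; rfl
  have hd' : coeffSum a 0 3 t ξ = ((-(l 0 * l 1 * l 2) : ℝ) : ℂ) := by
    rw [hd]; push_cast; rfl
  refine ⟨⟨?_, ?_, ?_⟩, l 0, l 1, l 2, ?_, ?_, ?_⟩ <;> simp only [cf, Nat.reduceSub, Nat.sub_zero]
  · rw [hb', Complex.ofReal_re]
  · rw [hc', Complex.ofReal_re]
  · rw [hd', Complex.ofReal_re]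
  · rw [hb', Complex.ofReal_re]
  · rw [hc', Complex.ofReal_re]
  · rw [hd', Complex.ofReal_re]

lemma eval_auxL_im_eq_zero (hL : WeaklyHyperbolic a T) (ht : t ∈ Set.Icc 0 T)
    (ξ : EuclideanSpace ℝ (Fin n)) (z : ℂ) (hz : (auxL a t ξ).eval z = 0) : z.im = 0 := by
  obtain ⟨⟨hb, hc, hd⟩, l₀, l₁, l₂, hl₁, hl₂, hl₃⟩ := exists_roots_symL hL ht ξ
  rw [auxL_eq, hb, hc, hd] at hz
  simp only [eval_add, eval_mul, eval_pow, eval_X, eval_C] at hz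
  have hre := congrArg Complex.re hz
  have him := congrArg Complex.im hz
  simp [pow_succ] at hre him
  exact im_eq_zero_of_cubic hl₁ hl₂ hl₃ (x := z.re) (by linarith) (by linarith)

/-- The factorization of the auxiliary polynomial. -/
lemma auxL_eq_prod (hL : WeaklyHyperbolic a T) (ht : t ∈ Set.Icc 0 T)
    (ξ : EuclideanSpace ℝ (Fin n)) : auxL a t ξ = ∏ j : Fin 3, (X - C (lam a j t ξ : ℂ)) := by
  have hmon := monic_cubic (coeffSum a 2 1 t ξ) (coeffSum a 1 2 t ξ - 6)
    (coeffSum a 0 3 t ξ - 2 * coeffSum a 2 1 t ξ)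
  rw [← auxL_eq] at hmon
  have h := eq_prod_orderedRoot (eval_auxL_im_eq_zero hL ht ξ) hmon.2
  rwa [hmon.1.leadingCoeff, map_one, one_mul] at h

lemma lam_vieta (hL : WeaklyHyperbolic a T) (ht : t ∈ Set.Icc 0 T)
    (ξ : EuclideanSpace ℝ (Fin n)) :
    cf a 2 t ξ = -(lam a 0 t ξ + lam a 1 t ξ + lam a 2 t ξ) ∧
    cf a 1 t ξ - 6 = lam a 0 t ξ * lam a 1 t ξ + lam a 0 t ξ * lam a 2 t ξ +
      lam a 1 t ξ * lam a 2 t ξ ∧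
    cf a 0 t ξ - 2 * cf a 2 t ξ = -(lam a 0 t ξ * lam a 1 t ξ * lam a 2 t ξ) := by
  have h := auxL_eq_prod hL ht ξ
  rw [Fin.prod_univ_three, auxL_eq] at h
  obtain ⟨h1, h2, h3⟩ := vieta_cubic h
  obtain ⟨⟨hb, hc, hd⟩, -⟩ := exists_roots_symL hL ht ξ
  rw [hb] at h1 h3
  rw [hc] at h2
  rw [hd] at h3
  exact ⟨by exact_mod_cast h1, by exact_mod_cast h2, by exact_mod_cast h3⟩

lemma lam_gaps (hL : WeaklyHyperbolic a T) (ht : t ∈ Set.Icc 0 T)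
    (ξ : EuclideanSpace ℝ (Fin n)) :
    8 / 3 ≤ (lam a 0 t ξ - lam a 1 t ξ) ^ 2 ∧ 8 / 3 ≤ (lam a 1 t ξ - lam a 2 t ξ) ^ 2 ∧
    8 / 3 ≤ (lam a 2 t ξ - lam a 0 t ξ) ^ 2 ∧
    864 ≤ (lam a 0 t ξ - lam a 1 t ξ) ^ 2 * (lam a 1 t ξ - lam a 2 t ξ) ^ 2 *
      (lam a 2 t ξ - lam a 0 t ξ) ^ 2 := by
  obtain ⟨h1, h2, h3⟩ := lam_vieta hL ht ξ
  obtain ⟨-, l₀, l₁, l₂, hl₁, hl₂, hl₃⟩ := exists_roots_symL hL ht ξ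
  exact gap_bounds (l₀ := l₀) (l₁ := l₁) (l₂ := l₂) (by linarith) (by linarith) (by linarith)

lemma lam_lt (hL : WeaklyHyperbolic a T) (ht : t ∈ Set.Icc 0 T)
    (ξ : EuclideanSpace ℝ (Fin n)) :
    lam a 0 t ξ < lam a 1 t ξ ∧ lam a 1 t ξ < lam a 2 t ξ := by
  have hmon := monic_cubic (coeffSum a 2 1 t ξ) (coeffSum a 1 2 t ξ - 6)
    (coeffSum a 0 3 t ξ - 2 * coeffSum a 2 1 t ξ)
  rw [← auxL_eq] at hmon
  obtain ⟨g1, g2, -⟩ := lam_gaps hL ht ξ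
  have h01 : lam a 0 t ξ ≤ lam a 1 t ξ := orderedRoot_le hmon.2 (by simp) (by simp)
  have h12 : lam a 1 t ξ ≤ lam a 2 t ξ := orderedRoot_le hmon.2 (by simp) (by simp)
  refine ⟨lt_of_le_of_ne h01 fun h => ?_, lt_of_le_of_ne h12 fun h => ?_⟩
  · rw [h] at g1
    norm_num at g1
  · rw [h] at g2
    norm_num at g2

/-- A quarter of the discriminant of the derivative of the auxiliary polynomial. -/
noncomputable def discD (a : Coeffs n) (t : ℝ) (ξ : EuclideanSpace ℝ (Fin n)) : ℝ :=
  cf a 2 t ξ ^ 2 - 3 * (cf a 1 t ξ - 6)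

/-- In terms of the roots of `L`, `b² - 3c` is half the sum of the squared differences, hence
nonnegative; the shift of `c` by 6 contributes 18. -/
lemma discD_ge (hL : WeaklyHyperbolic a T) (ht : t ∈ Set.Icc 0 T)
    (ξ : EuclideanSpace ℝ (Fin n)) : 18 ≤ discD a t ξ := by
  obtain ⟨-, l₀, l₁, l₂, hl₁, hl₂, -⟩ := exists_roots_symL hL ht ξ
  rw [discD, hl₁, hl₂]
  nlinarith [sq_nonneg (l₀ - l₁), sq_nonneg (l₀ - l₂), sq_nonneg (l₁ - l₂)]

lemma eval_derivative_auxL_im_eq_zero (hL : WeaklyHyperbolic a T) (ht : t ∈ Set.Icc 0 T)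
    (ξ : EuclideanSpace ℝ (Fin n)) (z : ℂ) (hz : (derivative (auxL a t ξ)).eval z = 0) :
    z.im = 0 := by
  obtain ⟨⟨hb, hc, -⟩, -⟩ := exists_roots_symL hL ht ξ
  have hge := discD_ge hL ht ξ
  rw [discD] at hge
  rw [derivative_auxL_eq, hb, hc] at hz
  simp only [eval_add, eval_mul, eval_pow, eval_X, eval_C] at hz
  have hre := congrArg Complex.re hz
  have him := congrArg Complex.im hz
  simp [pow_succ] at hre him
  by_contra hy
  have hx : 3 * z.re + cf a 2 t ξ = 0 := by
    refine (mul_eq_zero.1 (?_ : z.im * (3 * z.re + cf a 2 t ξ) = 0)).resolve_left hy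
    linarith
  have hx' : cf a 2 t ξ = -3 * z.re := by linarith
  rw [hx'] at hge hre
  nlinarith [sq_nonneg z.im]

lemma natDegree_derivative_auxL (a : Coeffs n) (t : ℝ) (ξ : EuclideanSpace ℝ (Fin n)) :
    (derivative (auxL a t ξ)).natDegree = 2 := by
  rw [derivative_auxL_eq]
  compute_degree!

/-- The factorization of the derivative of the auxiliary polynomial. -/
lemma derivative_auxL_eq_prod (hL : WeaklyHyperbolic a T) (ht : t ∈ Set.Icc 0 T)
    (ξ : EuclideanSpace ℝ (Fin n)) :
    derivative (auxL a t ξ) = C 3 * ∏ j : Fin 2, (X - C (mu a j t ξ : ℂ)) := by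
  have hdeg := natDegree_derivative_auxL a t ξ
  have h := eq_prod_orderedRoot (eval_derivative_auxL_im_eq_zero hL ht ξ) hdeg
  have hlead : (derivative (auxL a t ξ)).leadingCoeff = 3 := by
    rw [leadingCoeff, hdeg, derivative_auxL_eq]
    simp
  rwa [hlead] at h

/-- The quadratic formula for the roots of the derivative of the auxiliary polynomial. -/
lemma mu_eq (hL : WeaklyHyperbolic a T) (ht : t ∈ Set.Icc 0 T) (ξ : EuclideanSpace ℝ (Fin n)) :
    mu a 0 t ξ = (-cf a 2 t ξ - √(discD a t ξ)) / 3 ∧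
    mu a 1 t ξ = (-cf a 2 t ξ + √(discD a t ξ)) / 3 := by
  have h := derivative_auxL_eq_prod hL ht ξ
  rw [Fin.prod_univ_two, derivative_auxL_eq] at h
  have h0 := congrArg (eval 0) h
  have h1 := congrArg (eval 1) h
  simp only [eval_add, eval_mul, eval_pow, eval_X, eval_C, eval_sub] at h0 h1
  obtain ⟨⟨hb, hc, -⟩, -⟩ := exists_roots_symL hL ht ξ
  rw [hb, hc] at h1
  rw [hb, hc] at h0
  have e0 : cf a 1 t ξ - 6 = 3 * (mu a 0 t ξ * mu a 1 t ξ) := by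
    have : ((cf a 1 t ξ - 6 : ℝ) : ℂ) = ((3 * (mu a 0 t ξ * mu a 1 t ξ) : ℝ) : ℂ) := by
      push_cast
      linear_combination h0
    exact_mod_cast this
  have e1 : cf a 2 t ξ = -3 / 2 * (mu a 0 t ξ + mu a 1 t ξ) := by
    have : ((cf a 2 t ξ : ℝ) : ℂ) = ((-3 / 2 * (mu a 0 t ξ + mu a 1 t ξ) : ℝ) : ℂ) := by
      push_cast
      linear_combination (h1 - h0) / 2
    exact_mod_cast this
  have hle : mu a 0 t ξ ≤ mu a 1 t ξ :=
    orderedRoot_le (natDegree_derivative_auxL a t ξ) (by simp) (by simp)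
  have hsq : discD a t ξ = (3 / 2 * (mu a 1 t ξ - mu a 0 t ξ)) ^ 2 := by
    rw [discD, e0, e1]
    ring
  rw [hsq, Real.sqrt_sq (by linarith), e1]
  constructor <;> ring

lemma mu_lt (hL : WeaklyHyperbolic a T) (ht : t ∈ Set.Icc 0 T) (ξ : EuclideanSpace ℝ (Fin n)) :
    mu a 0 t ξ < mu a 1 t ξ := by
  obtain ⟨h0, h1⟩ := mu_eq hL ht ξ
  have : 0 < √(discD a t ξ) := Real.sqrt_pos.2 (by linarith [discD_ge hL ht ξ])
  rw [h0, h1]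
  linarith

end Symbols

end ThirdOrder

/-! ### Analytic dependence of simple roots. -/

namespace ThirdOrder

open Set Filter Topology
open scoped ContDiff

/-- A simple real root of a monic cubic depends analytically on the coefficients. -/
lemma exists_analyticAt_root {b c d : ℝ → ℝ} {t₀ x₀ : ℝ} (hb : AnalyticAt ℝ b t₀)
    (hc : AnalyticAt ℝ c t₀) (hd : AnalyticAt ℝ d t₀)
    (hx : x₀ ^ 3 + b t₀ * x₀ ^ 2 + c t₀ * x₀ + d t₀ = 0)
    (hx' : 3 * x₀ ^ 2 + 2 * b t₀ * x₀ + c t₀ ≠ 0) :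
    ∃ r : ℝ → ℝ, AnalyticAt ℝ r t₀ ∧ r t₀ = x₀ ∧
      ∀ᶠ t in 𝓝 t₀, r t ^ 3 + b t * r t ^ 2 + c t * r t + d t = 0 := by
  set f : ℝ × ℝ → ℝ := fun v => v.2 ^ 3 + b v.1 * v.2 ^ 2 + c v.1 * v.2 + d v.1 with hf
  have hfst : AnalyticAt ℝ (Prod.fst : ℝ × ℝ → ℝ) (t₀, x₀) := analyticAt_fst
  have hsnd : AnalyticAt ℝ (Prod.snd : ℝ × ℝ → ℝ) (t₀, x₀) := analyticAt_snd
  have hana : AnalyticAt ℝ f (t₀, x₀) :=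
    (((hsnd.pow 3).add ((hb.comp_of_eq hfst rfl).mul (hsnd.pow 2))).add
      ((hc.comp_of_eq hfst rfl).mul hsnd)).add (hd.comp_of_eq hfst rfl)
  have hcd : ContDiffAt ℝ ω f (t₀, x₀) := hana.contDiffAt
  have hder : (fderiv ℝ f (t₀, x₀) ∘L .inr ℝ ℝ ℝ) 1 = 3 * x₀ ^ 2 + 2 * b t₀ * x₀ + c t₀ := by
    have h1 : HasDerivAt (fun s : ℝ => f (t₀, s)) (fderiv ℝ f (t₀, x₀) (0, 1)) x₀ := by
      have hline : HasDerivAt (fun s : ℝ => (t₀, s)) (0, 1) x₀ :=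
        (hasDerivAt_const x₀ t₀).prodMk (hasDerivAt_id x₀)
      exact HasFDerivAt.comp_hasDerivAt x₀ hana.differentiableAt.hasFDerivAt hline
    have h2 : HasDerivAt (fun s : ℝ => f (t₀, s)) (3 * x₀ ^ 2 + 2 * b t₀ * x₀ + c t₀) x₀ := by
      have := ((((hasDerivAt_id x₀).pow 3).add (((hasDerivAt_id x₀).pow 2).const_mul (b t₀))).add
        ((hasDerivAt_id x₀).const_mul (c t₀))).add_const (d t₀)
      convert! this using 1
      simp
      ring
    simpa using h1.unique h2
  have hinv : (fderiv ℝ f (t₀, x₀) ∘L .inr ℝ ℝ ℝ).IsInvertible := by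
    refine ⟨ContinuousLinearEquiv.unitsEquivAut ℝ (Units.mk0 _ hx'), ?_⟩
    ext
    rw [hder]
    simp
  refine ⟨hcd.implicitFunction (by simp) hinv,
    (hcd.contDiffAt_implicitFunction (by simp) hinv).analyticAt,
    hcd.implicitFunction_apply_self (by simp) hinv, ?_⟩
  filter_upwards [hcd.eventually_apply_implicitFunction (by simp) hinv] with t ht
  exact ht.trans hx

/-! ### Low frequencies. -/

section Small

variable {E : Type*} [NormedAddCommGroup E] {T : ℝ}

/-- `g(t,ξ) = O(‖ξ‖)` for `‖ξ‖ ≤ 1`, uniformly in `t ∈ (0,T)`. -/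
def SmallBd (T : ℝ) (g : ℝ → E → ℝ) : Prop :=
  ∃ C : ℝ, 0 ≤ C ∧ ∀ t ∈ Ioo 0 T, ∀ ξ, ‖ξ‖ ≤ 1 → |g t ξ| ≤ C * ‖ξ‖

lemma SmallBd.mono {f g : ℝ → E → ℝ} (hf : SmallBd T f)
    (h : ∀ t ∈ Ioo 0 T, ∀ ξ, |g t ξ| ≤ |f t ξ|) : SmallBd T g := by
  obtain ⟨C, hC, hf⟩ := hf
  exact ⟨C, hC, fun t ht ξ hξ => (h t ht ξ).trans (hf t ht ξ hξ)⟩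

lemma SmallBd.congr {f g : ℝ → E → ℝ} (hf : SmallBd T f)
    (h : ∀ t ∈ Ioo 0 T, ∀ ξ, g t ξ = f t ξ) : SmallBd T g :=
  hf.mono fun t ht ξ => by rw [h t ht ξ]

lemma SmallBd.add {f g : ℝ → E → ℝ} (hf : SmallBd T f) (hg : SmallBd T g) :
    SmallBd T (f + g) := by
  obtain ⟨C, hC, hf⟩ := hf
  obtain ⟨D, hD, hg⟩ := hg
  refine ⟨C + D, by positivity, fun t ht ξ hξ => (abs_add_le _ _).trans ?_⟩
  rw [add_mul]
  exact add_le_add (hf t ht ξ hξ) (hg t ht ξ hξ)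

/-- On the unit ball `(1 + ‖ξ‖)^m ≤ 2^m`, so a polynomially bounded factor only changes the
constant. -/
lemma SmallBd.mul {f g : ℝ → E → ℝ} (hf : SmallBd T f) (hg : PolyBddOn (Ioo 0 T) g) :
    SmallBd T (f * g) := by
  obtain ⟨C, hC, hf⟩ := hf
  obtain ⟨D, m, hD, hg⟩ := hg
  refine ⟨C * (D * 2 ^ m), by positivity, fun t ht ξ hξ => ?_⟩
  rw [Pi.mul_apply, Pi.mul_apply, abs_mul]
  have h2 : |g t ξ| ≤ D * 2 ^ m := (hg t ht ξ).trans (by gcongr; linarith)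
  calc |f t ξ| * |g t ξ| ≤ (C * ‖ξ‖) * (D * 2 ^ m) :=
        mul_le_mul (hf t ht ξ hξ) h2 (abs_nonneg _) (by positivity)
    _ = _ := by ring

lemma SmallBd.neg {f : ℝ → E → ℝ} (hf : SmallBd T f) : SmallBd T (-f) :=
  hf.mono fun t _ ξ => by simp

lemma SmallBd.sub {f g : ℝ → E → ℝ} (hf : SmallBd T f) (hg : SmallBd T g) :
    SmallBd T (f - g) := by
  rw [sub_eq_add_neg]
  exact hf.add hg.neg

lemma SmallBd.sum {ι : Type*} (S : Finset ι) {f : ι → ℝ → E → ℝ}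
    (hf : ∀ i ∈ S, SmallBd T (f i)) : SmallBd T (∑ i ∈ S, f i) :=
  Finset.sum_induction f (SmallBd T) (fun _ _ => SmallBd.add) ⟨0, le_rfl, by simp⟩ hf

/-- `p(ξ) = O(‖ξ‖)` for `‖ξ‖ ≤ 1`. -/
def SmallFun (p : E → ℝ) : Prop := ∀ ξ, ‖ξ‖ ≤ 1 → |p ξ| ≤ ‖ξ‖

lemma SepSum.smallBd {g : ℝ → E → ℝ} (hg : SepSum T SmallFun g) : SmallBd T g := by
  obtain ⟨ι, _, b, p, hb, hp, h⟩ := hg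
  refine SmallBd.congr (f := ∑ k, fun t ξ => b k t * p k ξ) (SmallBd.sum _ fun k _ => ?_)
    fun t ht ξ => by simp [h t ht ξ, Finset.sum_apply]
  obtain ⟨C, hC⟩ := isCompact_Icc.exists_bound_of_continuousOn (hb k).continuousOn
  refine ⟨|C|, abs_nonneg _, fun t ht ξ hξ => ?_⟩
  rw [abs_mul]
  exact mul_le_mul ((hC t (Ioo_subset_Icc_self ht)).trans (le_abs_self C)) (hp k ξ hξ)
    (abs_nonneg _) (abs_nonneg _)

end Small

/-! ### Tameness of roots of cubics and of square roots. -/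

section CubicRoot

variable {E : Type*} [NormedAddCommGroup E] {T : ℝ}

lemma Tame.dt_mul {f g : ℝ → E → ℝ} (hf : Tame T f) (hg : Tame T g) :
    ∀ t ∈ Ioo 0 T, ∀ ξ, dt (f * g) t ξ = (dt f * g + f * dt g) t ξ := fun _ ht ξ =>
  ((hf.hasDerivAt ht ξ).mul (hg.hasDerivAt ht ξ)).deriv

lemma Tame.dt_add {f g : ℝ → E → ℝ} (hf : Tame T f) (hg : Tame T g) :
    ∀ t ∈ Ioo 0 T, ∀ ξ, dt (f + g) t ξ = (dt f + dt g) t ξ := fun _ ht ξ =>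
  ((hf.hasDerivAt ht ξ).add (hg.hasDerivAt ht ξ)).deriv

lemma isIntegral_of_cubic {b c d x : ℝ → E → ℝ} (hb : b ∈ fracAlg E T) (hc : c ∈ fracAlg E T)
    (hd : d ∈ fracAlg E T)
    (h : ∀ t ∈ Ioo 0 T, ∀ ξ, x t ξ ^ 3 + b t ξ * x t ξ ^ 2 + c t ξ * x t ξ + d t ξ = 0) :
    IsIntegral (fracAlg E T) x := by
  -- The cubic relation may fail for `t ∉ (0,T)`. Its defect vanishes on `(0,T)`, hence lies in the
  -- ring, and is subtracted from the constant coefficient.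
  have hr : x ^ 3 + b * x ^ 2 + c * x + d ∈ fracAlg E T :=
    sepAlg_le_fracAlg (mem_sepAlg_of_eq_zero h)
  have hd' := sub_mem hd hr
  open Polynomial in
  refine ⟨X ^ 3 + C ⟨b, hb⟩ * X ^ 2 + C ⟨c, hc⟩ * X + C ⟨_, hd'⟩, by monicity!, ?_⟩
  simp only [Polynomial.eval₂_add, Polynomial.eval₂_mul, Polynomial.eval₂_X_pow,
    Polynomial.eval₂_C, Polynomial.eval₂_X, Subalgebra.algebraMap_def,
    Algebra.algebraMap_self_apply]
  ring

/-- The discriminant of `x³ + b x² + c x + d`. -/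
def cubicDisc {R : Type*} [CommRing R] (b c d : R) : R :=
  b ^ 2 * c ^ 2 - 4 * c ^ 3 - 4 * b ^ 3 * d - 27 * d ^ 2 + 18 * b * c * d

lemma cubicDisc_apply {E : Type*} (b c d : ℝ → E → ℝ) (t : ℝ) (ξ : E) :
    cubicDisc b c d t ξ = cubicDisc (b t ξ) (c t ξ) (d t ξ) := rfl

/-- Dividing the cubic `f` by `X - x` leaves `X² + (b + x)X + (c + bx + x²)`; the discriminant of
`f` is `f'(x)²` times that of this quotient. -/
lemma sq_mul_eq_cubicDisc {b c d x : ℝ} (h : x ^ 3 + b * x ^ 2 + c * x + d = 0) :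
    (3 * x ^ 2 + 2 * b * x + c) ^ 2 * ((b + x) ^ 2 - 4 * (c + b * x + x ^ 2)) =
      cubicDisc b c d := by
  obtain rfl : d = -(x ^ 3 + b * x ^ 2 + c * x) := by linarith
  rw [cubicDisc]
  ring

/-- An analytic root of a monic cubic with coefficients in `sepAlg E T` and discriminant bounded
below is tame with all its derivatives up to order two; if the derivatives of the coefficients are
small for small `ξ`, then so are the derivatives of the root. -/
theorem tame_root {b c d x : ℝ → E → ℝ} (hb : b ∈ sepAlg E T) (hc : c ∈ sepAlg E T)
    (hd : d ∈ sepAlg E T) (hdisc : ∀ t ∈ Ioo 0 T, ∀ ξ, 1 ≤ cubicDisc (b t ξ) (c t ξ) (d t ξ))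
    (hx : ∀ ξ, AnalyticOnNhd ℝ (fun t => x t ξ) (Ioo 0 T))
    (h : ∀ t ∈ Ioo 0 T, ∀ ξ, x t ξ ^ 3 + b t ξ * x t ξ ^ 2 + c t ξ * x t ξ + d t ξ = 0)
    (hb' : SmallBd T (dt b)) (hc' : SmallBd T (dt c)) (hd' : SmallBd T (dt d))
    (hb'' : SmallBd T (dt (dt b))) (hc'' : SmallBd T (dt (dt c)))
    (hd'' : SmallBd T (dt (dt d))) :
    DTame T x ∧ DTame T (dt x) ∧ SmallBd T (dt x) ∧ SmallBd T (dt (dt x)) := by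
  have tb := SepSum.dTame hb
  have tc := SepSum.dTame hc
  have tb' := (SepSum.dt hb).dTame
  have tc' := (SepSum.dt hc).dTame
  have td' := (SepSum.dt hd).dTame
  have tx : Tame T x := ⟨hx, isIntegral_of_cubic (sepAlg_le_fracAlg hb) (sepAlg_le_fracAlg hc)
    (sepAlg_le_fracAlg hd) h⟩
  -- Here `q` is the derivative of the cubic at the root and `w` the `t`-derivative of the cubic at
  -- fixed `x`, so implicit differentiation reads `∂ₜx = -w / q`.
  let q : ℝ → E → ℝ := fun t ξ => 3 * x t ξ ^ 2 + 2 * b t ξ * x t ξ + c t ξ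
  let v : ℝ → E → ℝ := fun t ξ => (q t ξ)⁻¹
  let w : ℝ → E → ℝ := dt b * (x * x) + dt c * x + dt d
  have hmulq : ∀ t ∈ Ioo 0 T, ∀ ξ, q t ξ ≠ 0 := by
    intro t ht ξ h0
    have h1 := sq_mul_eq_cubicDisc (h t ht ξ)
    have h2 : 3 * x t ξ ^ 2 + 2 * b t ξ * x t ξ + c t ξ = 0 := h0
    rw [h2] at h1
    have := hdisc t ht ξ
    norm_num at h1
    linarith
  have tq : Tame T q := by
    have h1 := (((tx.mul tx).const_mul 3).add ((tb.1.mul tx).const_mul 2)).add tc.1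
    refine h1.congr fun t _ ξ => ?_
    simp only [Pi.add_apply, Pi.mul_apply, q]
    ring
  have hdmem : cubicDisc b c d ∈ sepAlg E T := by
    have h4 : (4 : ℝ → E → ℝ) ∈ sepAlg E T := ofNat_mem _ 4
    have h27 : (27 : ℝ → E → ℝ) ∈ sepAlg E T := ofNat_mem _ 27
    have h18 : (18 : ℝ → E → ℝ) ∈ sepAlg E T := ofNat_mem _ 18
    unfold cubicDisc
    exact add_mem (sub_mem (sub_mem (sub_mem (mul_mem (pow_mem hb 2) (pow_mem hc 2))
      (mul_mem h4 (pow_mem hc 3))) (mul_mem (mul_mem h4 (pow_mem hb 3)) hd))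
      (mul_mem h27 (pow_mem hd 2))) (mul_mem (mul_mem (mul_mem h18 hb) hc) hd)
  have tW : Tame T fun t ξ => (cubicDisc b c d t ξ)⁻¹ :=
    tame_of_mem_fracAlg (mem_fracAlg_of_mul_eq_one hdmem one_pos fun t ht ξ =>
      ⟨hdisc t ht ξ, inv_mul_cancel₀ (zero_lt_one.trans_le (hdisc t ht ξ)).ne'⟩)
  -- From `q² · o = disc`, with `o` the discriminant of the quotient quadratic, `1/q = q · o /
  -- disc`. Only the discriminant, an element of `sepAlg E T` bounded below, has to be inverted.
  have tv : Tame T v := by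
    have ho : Tame T ((b + x) * (b + x) - fun t ξ => 4 * (c + b * x + x * x) t ξ) :=
      ((tb.1.add tx).mul (tb.1.add tx)).sub (((tc.1.add (tb.1.mul tx)).add (tx.mul tx)).const_mul 4)
    refine ((tq.mul ho).mul tW).congr fun t ht ξ => ?_
    have h1 := sq_mul_eq_cubicDisc (h t ht ξ)
    have h2 := (zero_lt_one.trans_le (hdisc t ht ξ)).ne'
    have h3 := hmulq t ht ξ
    simp only [Pi.add_apply, Pi.mul_apply, Pi.sub_apply, cubicDisc_apply, v]
    rw [inv_eq_iff_eq_inv, eq_comm, inv_eq_iff_eq_inv, ← div_eq_mul_inv, div_eq_iff h2, ← h1]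
    field_simp
    simp only [q]
    ring
  have hxv : ∀ t ∈ Ioo 0 T, ∀ ξ, dt x t ξ = (-(w * v)) t ξ := by
    intro t ht ξ
    have hX := tx.hasDerivAt ht ξ
    have hB := tb.1.hasDerivAt ht ξ
    have hC := tc.1.hasDerivAt ht ξ
    have hD := (SepSum.tame hd).hasDerivAt ht ξ
    have hsum := (((hX.pow 3).add (hB.mul (hX.pow 2))).add (hC.mul hX)).add hD
    have hzero : HasDerivAt (fun _ : ℝ => (0 : ℝ)) 0 t := hasDerivAt_const t 0
    have heq := (hzero.congr_of_eventuallyEq (f₁ := fun s =>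
      x s ξ ^ 3 + b s ξ * x s ξ ^ 2 + c s ξ * x s ξ + d s ξ) (by
        filter_upwards [isOpen_Ioo.mem_nhds ht] with s hs using h s hs ξ)).unique hsum
    have h3 := hmulq t ht ξ
    simp only [Pi.neg_apply, Pi.mul_apply, Pi.add_apply, w, v]
    rw [← div_eq_mul_inv, ← neg_div, eq_div_iff h3]
    simp only [q]
    push_cast at heq
    norm_num at heq
    linear_combination -heq
  have tw : Tame T w := ((tb'.1.mul (tx.mul tx)).add (tc'.1.mul tx)).add td'.1
  have dx : DTame T x := ⟨tx, (tw.mul tv).neg.congr hxv⟩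
  have dq : DTame T q := by
    have h1 := (((dx.mul dx).const_mul 3).add ((tb.mul dx).const_mul 2)).add tc
    refine h1.congr fun t _ ξ => ?_
    simp only [Pi.add_apply, Pi.mul_apply, q]
    ring
  have dv : DTame T v := by
    -- The rule `∂ₜ(1/q) = -∂ₜq · (1/q)²` needs no new inverse.
    refine ⟨tv, (dq.2.mul (tv.mul tv)).neg.congr fun t ht ξ => ?_⟩
    have := ((dq.1.hasDerivAt ht ξ).fun_inv (hmulq t ht ξ)).deriv
    simp only [dt, Pi.neg_apply, Pi.mul_apply, v] at this ⊢
    rw [this]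
    field_simp
  have dw : DTame T w := ((tb'.mul (dx.mul dx)).add (tc'.mul dx)).add td'
  have dx' : DTame T (dt x) := (dw.mul dv).neg.congr hxv
  have sw : SmallBd T w := ((hb'.mul (tx.mul tx).polyBddOn).add (hc'.mul tx.polyBddOn)).add hd'
  have sx' : SmallBd T (dt x) := (sw.mul tv.polyBddOn).neg.congr hxv
  have sw' : SmallBd T (dt w) := by
    refine (((hb''.mul (tx.mul tx).polyBddOn).add (hb'.mul (dx.mul dx).2.polyBddOn)).add
      ((hc''.mul tx.polyBddOn).add (hc'.mul dx.2.polyBddOn))).add hd'' |>.congr fun t ht ξ => ?_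
    rw [Tame.dt_add ((tb'.1.mul (tx.mul tx)).add (tc'.1.mul tx)) td'.1 t ht ξ]
    simp only [Pi.add_apply]
    rw [Tame.dt_add (tb'.1.mul (tx.mul tx)) (tc'.1.mul tx) t ht ξ]
    simp only [Pi.add_apply]
    rw [Tame.dt_mul tb'.1 (tx.mul tx) t ht ξ, Tame.dt_mul tc'.1 tx t ht ξ]
    rfl
  refine ⟨dx, dx', sx', ((sw'.mul tv.polyBddOn).add (sw.mul dv.2.polyBddOn)).neg.mono
    fun t ht ξ => ?_⟩
  rw [dt_eq_of_eqOn hxv t ht ξ]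
  have h1 : dt (-(w * v)) t ξ = -dt (w * v) t ξ := by
    simp only [dt, Pi.neg_apply]
    exact deriv.fun_neg
  rw [h1, Tame.dt_mul tw tv t ht ξ]
  rfl

/-- A positive square root of an element of `sepAlg E T` that is bounded below is tame. -/
theorem tame_sqrt {u : ℝ → E → ℝ} (hu : u ∈ sepAlg E T) (hpos : ∀ t ∈ Ioo 0 T, ∀ ξ, 1 ≤ u t ξ) :
    DTame T fun t ξ => √(u t ξ) := by
  have tu := SepSum.dTame hu
  have hpos' : ∀ t ∈ Ioo 0 T, ∀ ξ, 0 < u t ξ := fun t ht ξ => one_pos.trans_le (hpos t ht ξ)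
  have tw : Tame T fun t ξ => √(u t ξ) := by
    refine ⟨fun ξ t ht => ?_, IsIntegral.of_pow two_pos
      (isIntegral_congr tu.1.2 fun t ht ξ => Real.sq_sqrt (hpos' t ht ξ).le)⟩
    exact (Real.contDiffAt_sqrt (n := ω) (hpos' t ht ξ).ne').analyticAt.fun_comp
      (f := fun t => u t ξ) (tu.1.1 ξ t ht)
  have tinv : Tame T fun t ξ => (u t ξ)⁻¹ :=
    tame_of_mem_fracAlg (mem_fracAlg_of_mul_eq_one hu one_pos fun t ht ξ =>
      ⟨hpos t ht ξ, inv_mul_cancel₀ (hpos' t ht ξ).ne'⟩)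
  -- Writing `1/√u` as `√u · u⁻¹` leaves only `u` to be inverted.
  refine ⟨tw, ((tu.2.mul (tw.mul tinv)).const_mul (1 / 2)).congr fun t ht ξ => ?_⟩
  have h1 := ((tu.1.hasDerivAt ht ξ).sqrt (hpos' t ht ξ).ne').deriv
  have h2 : √(u t ξ) ≠ 0 := (Real.sqrt_pos.2 (hpos' t ht ξ)).ne'
  have h3 : √(u t ξ) * √(u t ξ) = u t ξ := Real.mul_self_sqrt (hpos' t ht ξ).le
  simp only [dt, Pi.mul_apply] at h1 ⊢
  rw [h1, div_eq_iff (by positivity)]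
  have h4 := (hpos' t ht ξ).ne'
  have h5 : 1 / 2 * (deriv (fun s => u s ξ) t * (√(u t ξ) * (u t ξ)⁻¹)) * (2 * √(u t ξ)) =
      deriv (fun s => u s ξ) t * ((√(u t ξ) * √(u t ξ)) * (u t ξ)⁻¹) := by ring
  rw [h5, h3, mul_inv_cancel₀ h4, mul_one]

end CubicRoot

/-! ### From `log (2 + |ξ|)` to `log (1 + |ξ|)`. -/

section LogConditions

variable {n : ℕ} {T : ℝ} {F : ℝ → EuclideanSpace ℝ (Fin n) → ℝ}

/-- Here `log (2 + r) ≤ log 2 + log (1 + r)`, and for `r ≥ R` the constant `log 2` is a multiple of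
`log (1 + r)`. -/
lemma LogBdd.logCondition_of_le (hF : LogBdd T F) {R : ℝ} (hR : 0 < R) :
    LogCondition T {ξ | R ≤ ‖ξ‖} F := by
  obtain ⟨hint, C, hC, hle⟩ := hF
  have hlogR : 0 < Real.log (1 + R) := Real.log_pos (by linarith)
  have hlog2 : 0 < Real.log 2 := Real.log_pos one_lt_two
  refine ⟨fun ξ _ => hint ξ, C * (Real.log 2 / Real.log (1 + R) + 1), by positivity,
    fun ξ hξ => (hle ξ).trans ?_⟩
  have hξ' : R ≤ ‖ξ‖ := hξ
  rw [mul_assoc]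
  refine mul_le_mul_of_nonneg_left ?_ hC.le
  have h1 : Real.log (2 + ‖ξ‖) ≤ Real.log 2 + Real.log (1 + ‖ξ‖) := by
    rw [← Real.log_mul two_ne_zero (by positivity)]
    exact Real.log_le_log (by positivity) (by linarith [norm_nonneg ξ])
  have h2 : Real.log (1 + R) ≤ Real.log (1 + ‖ξ‖) := Real.log_le_log (by linarith) (by linarith)
  have h3 : Real.log 2 ≤ Real.log 2 / Real.log (1 + R) * Real.log (1 + ‖ξ‖) := by
    rw [div_mul_eq_mul_div, le_div_iff₀ hlogR]
    exact mul_le_mul_of_nonneg_left h2 hlog2.le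
  linarith

/-- For `|ξ| ≤ 1` the integral is at most `T D |ξ|`, and `log (1 + r) ≥ r / (1 + r) ≥ r / 2` on
`[0,1]`. -/
lemma LogBdd.logCondition_univ (hT : 0 < T) (hF : LogBdd T F) (hs : SmallBd T F) :
    LogCondition T Set.univ F := by
  obtain ⟨hint, C, hC, hle⟩ := hF.logCondition_of_le one_pos
  obtain ⟨D, hD, hs⟩ := hs
  refine ⟨fun ξ _ => hF.1 ξ, C + 2 * (T * D), by positivity, fun ξ _ => ?_⟩
  have hlog : 0 ≤ Real.log (1 + ‖ξ‖) := Real.log_nonneg (by linarith [norm_nonneg ξ])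
  rcases le_total 1 ‖ξ‖ with hξ | hξ
  · refine (hle ξ hξ).trans (mul_le_mul_of_nonneg_right ?_ hlog)
    have : 0 ≤ T * D := by positivity
    linarith
  · have h1 : ∫ t in (0 : ℝ)..T, |F t ξ| ≤ T * (D * ‖ξ‖) := by
      have := integral_le_integral_of_le_Ioo hT (hF.1 ξ).abs
        (intervalIntegrable_const (c := D * ‖ξ‖)) fun t ht => hs t ht ξ hξ
      simpa [mul_left_comm] using this
    have h2 : ‖ξ‖ / 2 ≤ Real.log (1 + ‖ξ‖) := by
      have hpos : 0 < 1 + ‖ξ‖ := by positivity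
      refine le_trans ?_ (Real.one_sub_inv_le_log_of_pos hpos)
      rw [← sub_nonneg]
      have : 1 - (1 + ‖ξ‖)⁻¹ - ‖ξ‖ / 2 = ‖ξ‖ * (1 - ‖ξ‖) / (2 * (1 + ‖ξ‖)) := by
        field_simp
        ring
      rw [this]
      have : 0 ≤ 1 - ‖ξ‖ := by linarith
      positivity
    have h3 : 0 ≤ T * D := by positivity
    nlinarith

end LogConditions

end ThirdOrder

/-! ### Separated structure of the coefficients. -/

namespace ThirdOrder

open Set Filter Topology

section Complex

variable {E : Type*} [NormedAddCommGroup E] {T : ℝ}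

/-- The real and imaginary parts belong to `sepAlg E T`. -/
def CSep (T : ℝ) (h : ℝ → E → ℂ) : Prop :=
  SepSum T PolyBdd (fun t ξ => (h t ξ).re) ∧ SepSum T PolyBdd (fun t ξ => (h t ξ).im)

lemma CSep.cTame {h : ℝ → E → ℂ} (hh : CSep T h) : CTame T h := ⟨hh.1.dTame, hh.2.dTame⟩

lemma CSep.dtc {h : ℝ → E → ℂ} (hh : CSep T h) : CSep T (dtc h) :=
  ⟨hh.1.dt.congr fun t ht ξ => by simp [hh.cTame.dtc_eq ht ξ],
    hh.2.dt.congr fun t ht ξ => by simp [hh.cTame.dtc_eq ht ξ]⟩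

end Complex

section Coefficients

variable {n : ℕ} {a : Coeffs n} {T : ℝ} {j k : ℕ}

lemma abs_monomial_le (α : Fin n → ℕ) (ξ : EuclideanSpace ℝ (Fin n)) :
    |∏ i, ξ i ^ α i| ≤ ‖ξ‖ ^ ∑ i, α i := by
  rw [Finset.abs_prod, ← Finset.prod_pow_eq_pow_sum]
  refine Finset.prod_le_prod (fun i _ => abs_nonneg _) fun i _ => ?_
  rw [abs_pow]
  exact pow_le_pow_left₀ (abs_nonneg _) (PiLp.norm_apply_le ξ i) _

lemma polyBdd_monomial (α : Fin n → ℕ) :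
    PolyBdd fun ξ : EuclideanSpace ℝ (Fin n) => ∏ i, ξ i ^ α i :=
  ⟨1, ∑ i, α i, zero_le_one, fun _ _ ξ => by
    rw [one_mul]
    exact (abs_monomial_le α ξ).trans (pow_le_pow_left₀ (norm_nonneg _) (by linarith) _)⟩

lemma smallFun_monomial {α : Fin n → ℕ} (hα : ∑ i, α i ≠ 0) :
    SmallFun fun ξ : EuclideanSpace ℝ (Fin n) => ∏ i, ξ i ^ α i := fun ξ hξ =>
  (abs_monomial_le α ξ).trans (pow_le_of_le_one (norm_nonneg _) hξ hα)

lemma AnalyticCoeffs.analyticOnNhd (ha : AnalyticCoeffs a T) (hj : j ≤ 2) (hjk : j + k ≤ 3)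
    {α : Fin n → ℕ} (hα : α ∈ Finset.piAntidiag Finset.univ k) :
    AnalyticOnNhd ℝ (a j α) (Icc 0 T) := by
  refine ha j α hj ?_
  rw [(Finset.mem_piAntidiag.1 hα).1]
  exact hjk

lemma analyticOnNhd_coeffSum (ha : AnalyticCoeffs a T) (hj : j ≤ 2) (hjk : j + k ≤ 3)
    (ξ : EuclideanSpace ℝ (Fin n)) :
    AnalyticOnNhd ℝ (fun t => coeffSum a j k t ξ) (Icc 0 T) :=
  Finset.analyticOnNhd_fun_sum _ fun _ hα => (ha.analyticOnNhd hj hjk hα).mul analyticOnNhd_const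

lemma sepSum_coeffSum (ha : AnalyticCoeffs a T) (hj : j ≤ 2) (hjk : j + k ≤ 3)
    {Q : (EuclideanSpace ℝ (Fin n) → ℝ) → Prop}
    (hQ : ∀ α ∈ Finset.piAntidiag (Finset.univ : Finset (Fin n)) k, Q fun ξ => ∏ i, ξ i ^ α i) :
    SepSum T Q (fun t ξ => (coeffSum a j k t ξ).re) ∧
    SepSum T Q (fun t ξ => (coeffSum a j k t ξ).im) := by
  have hprod : ∀ (z : ℂ) (α : Fin n → ℕ) (ξ : EuclideanSpace ℝ (Fin n)),
      z * ∏ i, (ξ i : ℂ) ^ α i = z * ((∏ i, ξ i ^ α i : ℝ) : ℂ) := fun z α ξ => by push_cast; rfl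
  refine ⟨⟨Finset.piAntidiag (Finset.univ : Finset (Fin n)) k, inferInstance,
    fun α t => (a j α t).re, fun α ξ => ∏ i, ξ i ^ (α : Fin n → ℕ) i,
    fun α => (Complex.reCLM.analyticOnNhd univ).comp (ha.analyticOnNhd hj hjk α.2) (mapsTo_univ _ _),
    fun α => hQ α α.2, fun t _ ξ => ?_⟩, ⟨Finset.piAntidiag (Finset.univ : Finset (Fin n)) k,
    inferInstance, fun α t => (a j α t).im, fun α ξ => ∏ i, ξ i ^ (α : Fin n → ℕ) i,
    fun α => (Complex.imCLM.analyticOnNhd univ).comp (ha.analyticOnNhd hj hjk α.2) (mapsTo_univ _ _),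
    fun α => hQ α α.2, fun t _ ξ => ?_⟩⟩
  · simp only [coeffSum, Complex.re_sum, hprod, Complex.re_mul_ofReal]
    exact (Finset.sum_coe_sort (Finset.piAntidiag (Finset.univ : Finset (Fin n)) k)
      fun α => (a j α t).re * ∏ i, ξ i ^ α i).symm
  · simp only [coeffSum, Complex.im_sum, hprod, Complex.im_mul_ofReal]
    exact (Finset.sum_coe_sort (Finset.piAntidiag (Finset.univ : Finset (Fin n)) k)
      fun α => (a j α t).im * ∏ i, ξ i ^ α i).symm

lemma cSep_coeffSum (ha : AnalyticCoeffs a T) (hj : j ≤ 2) (hjk : j + k ≤ 3) :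
    CSep T (coeffSum a j k) :=
  sepSum_coeffSum ha hj hjk fun α _ => polyBdd_monomial α

/-- The coefficient of `τ^j` in `L` is homogeneous of degree `3 - j ≥ 1` in `ξ`, which gives the
smallness near `ξ = 0`. -/
lemma sepSum_cf (ha : AnalyticCoeffs a T) (hj : j ≤ 2) :
    SepSum T PolyBdd (cf a j) ∧ SepSum T SmallFun (cf a j) :=
  ⟨(sepSum_coeffSum ha hj (by omega) fun α _ => polyBdd_monomial α).1,
    (sepSum_coeffSum ha hj (by omega) fun α hα => smallFun_monomial (by
      rw [(Finset.mem_piAntidiag.1 hα).1]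
      omega)).1⟩

lemma analyticOnNhd_cf (ha : AnalyticCoeffs a T) (hj : j ≤ 2) (ξ : EuclideanSpace ℝ (Fin n)) :
    AnalyticOnNhd ℝ (fun t => cf a j t ξ) (Icc 0 T) :=
  (Complex.reCLM.analyticOnNhd univ).comp (analyticOnNhd_coeffSum ha hj (by omega) ξ)
    (mapsTo_univ _ _)

end Coefficients

/-! ### Regularity and tameness of `λⱼ` and `μⱼ`. -/

section Roots

variable {n : ℕ} {a : Coeffs n} {T t : ℝ}

lemma lam_root (hL : WeaklyHyperbolic a T) (ht : t ∈ Icc 0 T) (ξ : EuclideanSpace ℝ (Fin n))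
    (j : Fin 3) : lam a j t ξ ^ 3 + cf a 2 t ξ * lam a j t ξ ^ 2 + (cf a 1 t ξ - 6) * lam a j t ξ +
      (cf a 0 t ξ - 2 * cf a 2 t ξ) = 0 := by
  obtain ⟨h1, h2, h3⟩ := lam_vieta hL ht ξ
  rw [h2, h3, h1]
  fin_cases j <;> simp only [Fin.zero_eta, Fin.mk_one, Fin.reduceFinMk] <;> ring

lemma lam_disc (hL : WeaklyHyperbolic a T) (ht : t ∈ Icc 0 T) (ξ : EuclideanSpace ℝ (Fin n)) :
    1 ≤ cubicDisc (cf a 2 t ξ) (cf a 1 t ξ - 6) (cf a 0 t ξ - 2 * cf a 2 t ξ) := by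
  obtain ⟨h1, h2, h3⟩ := lam_vieta hL ht ξ
  obtain ⟨-, -, -, h⟩ := lam_gaps hL ht ξ
  rw [h2, h3, h1]
  refine le_trans (by norm_num) (h.trans_eq ?_)
  rw [cubicDisc]
  ring

/-- The implicit function theorem gives three analytic branches, which keep their strict order near
`t` and so coincide with the ordered roots. The agreement is restricted to `[0,T]`, as
real-rootedness is unknown outside. -/
lemma exists_analyticAt_lam (ha : AnalyticCoeffs a T) (hL : WeaklyHyperbolic a T)
    (ht : t ∈ Icc 0 T) (ξ : EuclideanSpace ℝ (Fin n)) (j : Fin 3) :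
    ∃ r : ℝ → ℝ, AnalyticAt ℝ r t ∧ ∀ᶠ s in 𝓝 t, s ∈ Icc 0 T → lam a j s ξ = r s := by
  have hb := analyticOnNhd_cf ha (j := 2) le_rfl ξ t ht
  have hc := (analyticOnNhd_cf ha (j := 1) one_le_two ξ t ht).sub
    (analyticAt_const (v := (6 : ℝ)))
  have hd := (analyticOnNhd_cf ha (j := 0) zero_le_two ξ t ht).sub
    ((analyticAt_const (v := (2 : ℝ))).mul hb)
  have hroot : ∀ j : Fin 3, ∃ r : ℝ → ℝ, AnalyticAt ℝ r t ∧ r t = lam a j t ξ ∧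
      ∀ᶠ s in 𝓝 t, r s ^ 3 + cf a 2 s ξ * r s ^ 2 + (cf a 1 s ξ - 6) * r s +
        (cf a 0 s ξ - 2 * cf a 2 s ξ) = 0 := fun j => by
    refine exists_analyticAt_root hb hc hd (lam_root hL ht ξ j) fun h0 => ?_
    have h1 := sq_mul_eq_cubicDisc (lam_root hL ht ξ j)
    have h2 := lam_disc hL ht ξ
    rw [← h1] at h2
    have h0' : 3 * lam a j t ξ ^ 2 + 2 * cf a 2 t ξ * lam a j t ξ + (cf a 1 t ξ - 6) = 0 := h0
    rw [h0'] at h2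
    norm_num at h2
  choose r hr hrt hr0 using hroot
  refine ⟨r j, hr j, ?_⟩
  obtain ⟨hlt1, hlt2⟩ := lam_lt hL ht ξ
  have e1 : ∀ᶠ s in 𝓝 t, r 0 s < r 1 s :=
    (hr 0).continuousAt.eventually_lt (hr 1).continuousAt (by rwa [hrt, hrt])
  have e2 : ∀ᶠ s in 𝓝 t, r 1 s < r 2 s :=
    (hr 1).continuousAt.eventually_lt (hr 2).continuousAt (by rwa [hrt, hrt])
  filter_upwards [e1, e2, eventually_all.2 hr0] with s h1 h2 h0 hs
  obtain ⟨v1, v2, v3⟩ := lam_vieta hL hs ξ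
  obtain ⟨l1, l2⟩ := lam_lt hL hs ξ
  have hmem : ∀ i, r i s = lam a 0 s ξ ∨ r i s = lam a 1 s ξ ∨ r i s = lam a 2 s ξ := by
    intro i
    have hi := h0 i
    rw [v2, v3, v1] at hi
    have : (r i s - lam a 0 s ξ) * ((r i s - lam a 1 s ξ) * (r i s - lam a 2 s ξ)) = 0 := by
      rw [← hi]
      ring
    simpa [sub_eq_zero] using this
  -- Of the 27 assignments of branches to roots, only the identity is compatible with both strict
  -- orders.
  have key : lam a 0 s ξ = r 0 s ∧ lam a 1 s ξ = r 1 s ∧ lam a 2 s ξ = r 2 s := by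
    rcases hmem 0 with h | h | h <;> rcases hmem 1 with h' | h' | h' <;>
      rcases hmem 2 with h'' | h'' | h'' <;>
      first
        | exact ⟨h.symm, h'.symm, h''.symm⟩
        | (exfalso; linarith)
  fin_cases j
  exacts [key.1, key.2.1, key.2.2]

lemma analyticOn_lam (ha : AnalyticCoeffs a T) (hL : WeaklyHyperbolic a T)
    (ξ : EuclideanSpace ℝ (Fin n)) (j : Fin 3) :
    AnalyticOn ℝ (fun t => lam a j t ξ) (Icc 0 T) := by
  intro t ht
  obtain ⟨r, hr, he⟩ := exists_analyticAt_lam ha hL ht ξ j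
  exact hr.analyticWithinAt.congr_of_eventuallyEq (eventually_nhdsWithin_iff.2 he)
    (he.self_of_nhds ht)

lemma analyticOnNhd_lam (ha : AnalyticCoeffs a T) (hL : WeaklyHyperbolic a T)
    (ξ : EuclideanSpace ℝ (Fin n)) (j : Fin 3) :
    AnalyticOnNhd ℝ (fun t => lam a j t ξ) (Ioo 0 T) :=
  isOpen_Ioo.analyticOn_iff_analyticOnNhd.1 ((analyticOn_lam ha hL ξ j).mono Ioo_subset_Icc_self)

lemma analyticOn_mu (ha : AnalyticCoeffs a T) (hL : WeaklyHyperbolic a T)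
    (ξ : EuclideanSpace ℝ (Fin n)) (j : Fin 2) :
    AnalyticOn ℝ (fun t => mu a j t ξ) (Icc 0 T) := by
  have hb := analyticOnNhd_cf ha (j := 2) le_rfl ξ
  have hdisc : AnalyticOnNhd ℝ (fun t => discD a t ξ) (Icc 0 T) :=
    (hb.pow 2).sub (analyticOnNhd_const.mul
      ((analyticOnNhd_cf ha (j := 1) one_le_two ξ).sub analyticOnNhd_const))
  have hsqrt : AnalyticOnNhd ℝ (fun t => √(discD a t ξ)) (Icc 0 T) := fun t ht =>
    (Real.contDiffAt_sqrt (n := ⊤) (by linarith [discD_ge hL ht ξ])).analyticAt.fun_comp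
      (f := fun t => discD a t ξ) (hdisc t ht)
  have h3 : ∀ t ∈ Icc 0 T, (3 : ℝ) ≠ 0 := fun _ _ => three_ne_zero
  fin_cases j
  · exact ((hb.neg.sub hsqrt).div analyticOnNhd_const h3).analyticOn.congr
      fun t ht => (mu_eq hL ht ξ).1
  · exact ((hb.neg.add hsqrt).div analyticOnNhd_const h3).analyticOn.congr
      fun t ht => (mu_eq hL ht ξ).2

theorem rootsRegular (ha : AnalyticCoeffs a T) (hL : WeaklyHyperbolic a T) : RootsRegular a T :=
  fun ξ => ⟨fun _ ht => ⟨auxL_eq_prod hL ht ξ, (lam_lt hL ht ξ).1, (lam_lt hL ht ξ).2,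
    derivative_auxL_eq_prod hL ht ξ, mu_lt hL ht ξ⟩, analyticOn_lam ha hL ξ, analyticOn_mu ha hL ξ⟩

lemma dt_sub_const_mul {f g : ℝ → EuclideanSpace ℝ (Fin n) → ℝ} (hf : Tame T f) (hg : Tame T g)
    (c : ℝ) : ∀ t ∈ Ioo 0 T, ∀ ξ, dt (fun t ξ => f t ξ - c * g t ξ) t ξ =
      dt f t ξ - c * dt g t ξ := fun _ ht ξ =>
  ((hf.hasDerivAt ht ξ).sub ((hg.hasDerivAt ht ξ).const_mul c)).deriv

theorem tame_lam (ha : AnalyticCoeffs a T) (hL : WeaklyHyperbolic a T) (j : Fin 3) :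
    DTame T (lam a j) ∧ DTame T (dt (lam a j)) ∧ SmallBd T (dt (lam a j)) ∧
      SmallBd T (dt (dt (lam a j))) := by
  obtain ⟨b1, b2⟩ := sepSum_cf ha (j := 2) le_rfl
  obtain ⟨c1, c2⟩ := sepSum_cf ha (j := 1) one_le_two
  obtain ⟨d1, d2⟩ := sepSum_cf ha (j := 0) zero_le_two
  have mc : (fun t ξ => cf a 1 t ξ - 6) ∈ sepAlg (EuclideanSpace ℝ (Fin n)) T :=
    sub_mem (mem_sepAlg.2 c1) (mem_sepAlg.2 (sepSum_const 6))
  have md : (fun t ξ => cf a 0 t ξ - 2 * cf a 2 t ξ) ∈ sepAlg (EuclideanSpace ℝ (Fin n)) T :=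
    sub_mem (mem_sepAlg.2 d1) (mul_mem (mem_sepAlg.2 (sepSum_const 2)) (mem_sepAlg.2 b1))
  have ec : dt (fun t ξ => cf a 1 t ξ - 6) = dt (cf a 1) := by
    funext t ξ
    exact deriv_sub_const _
  have ed := dt_sub_const_mul d1.tame b1.tame 2
  have ed' : ∀ t ∈ Ioo 0 T, ∀ ξ, dt (dt fun t ξ => cf a 0 t ξ - 2 * cf a 2 t ξ) t ξ =
      dt (dt (cf a 0)) t ξ - 2 * dt (dt (cf a 2)) t ξ := fun t ht ξ =>
    (dt_eq_of_eqOn ed t ht ξ).trans (dt_sub_const_mul d1.dt.tame b1.dt.tame 2 t ht ξ)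
  have two : ∀ {f : ℝ → EuclideanSpace ℝ (Fin n) → ℝ}, SmallBd T f →
      SmallBd T fun t ξ => 2 * f t ξ := fun hf =>
    (hf.mul (PolyBddOn.of_bounded (f := fun _ _ => (2 : ℝ)) (C := 2) (by simp))).congr
      fun t _ ξ => mul_comm _ _
  exact tame_root (mem_sepAlg.2 b1) mc md
    (fun t ht ξ => lam_disc hL (Ioo_subset_Icc_self ht) ξ)
    (fun ξ => analyticOnNhd_lam ha hL ξ j)
    (fun t ht ξ => lam_root hL (Ioo_subset_Icc_self ht) ξ j)
    b2.dt.smallBd (by rw [ec]; exact c2.dt.smallBd)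
    ((d2.dt.smallBd.sub (two b2.dt.smallBd)).congr ed)
    b2.dt.dt.smallBd (by rw [ec]; exact c2.dt.dt.smallBd)
    ((d2.dt.dt.smallBd.sub (two b2.dt.dt.smallBd)).congr ed')

theorem tame_mu (ha : AnalyticCoeffs a T) (hL : WeaklyHyperbolic a T) (j : Fin 2) :
    DTame T (mu a j) := by
  have b1 := (sepSum_cf ha (j := 2) le_rfl).1
  have c1 := (sepSum_cf ha (j := 1) one_le_two).1
  have hmem : discD a ∈ sepAlg (EuclideanSpace ℝ (Fin n)) T :=
    sub_mem (pow_mem (mem_sepAlg.2 b1) 2) (mul_mem (mem_sepAlg.2 (sepSum_const 3))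
      (sub_mem (mem_sepAlg.2 c1) (mem_sepAlg.2 (sepSum_const 6))))
  have hs := tame_sqrt hmem fun t ht ξ => by
    linarith [discD_ge hL (Ioo_subset_Icc_self ht) ξ]
  fin_cases j
  · refine ((b1.dTame.neg.sub hs).const_mul (1 / 3)).congr fun t ht ξ => ?_
    refine (mu_eq hL (Ioo_subset_Icc_self ht) ξ).1.trans ?_
    simp only [Pi.sub_apply, Pi.neg_apply]
    ring
  · refine ((b1.dTame.neg.add hs).const_mul (1 / 3)).congr fun t ht ξ => ?_
    refine (mu_eq hL (Ioo_subset_Icc_self ht) ξ).2.trans ?_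
    simp only [Pi.add_apply, Pi.neg_apply]
    ring

end Roots

/-! ### Tameness of `M̌` and `Ň` along the roots. -/

section LowerOrder

open Polynomial

variable {n : ℕ} {a : Coeffs n} {T t : ℝ}

/-- The time derivative is taken at frozen `τ`, so `∂_τ L = 3τ² + 2bτ + c` contributes `-b'τ -
c'/2`. The result is polynomial in `τ`, with separated coefficients. -/
lemma checkM_eq (ha : AnalyticCoeffs a T) (ht : t ∈ Ioo 0 T) (τ : ℂ)
    (ξ : EuclideanSpace ℝ (Fin n)) :
    checkM a t τ ξ = coeffSum a 2 0 t ξ * (τ * τ) + coeffSum a 1 1 t ξ * τ + coeffSum a 0 2 t ξ +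
      ((-1 : ℝ) * (dtc (coeffSum a 2 1) t ξ * τ) + (-1 / 2 : ℝ) * dtc (coeffSum a 1 2) t ξ) := by
  have hev : ∀ s, (derivative (symL a s ξ)).eval τ =
      3 * τ ^ 2 + (2 * τ) * coeffSum a 2 1 s ξ + coeffSum a 1 2 s ξ := fun s => by
    rw [symL_eq]
    simp
    ring
  have h2 : HasDerivAt (fun s => coeffSum a 2 1 s ξ) (dtc (coeffSum a 2 1) t ξ) t :=
    (analyticOnNhd_coeffSum ha le_rfl le_rfl ξ t
      (Ioo_subset_Icc_self ht)).differentiableAt.hasDerivAt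
  have h1 : HasDerivAt (fun s => coeffSum a 1 2 s ξ) (dtc (coeffSum a 1 2) t ξ) t :=
    (analyticOnNhd_coeffSum ha one_le_two le_rfl ξ t
      (Ioo_subset_Icc_self ht)).differentiableAt.hasDerivAt
  have hd := (((h2.const_mul (2 * τ)).const_add (3 * τ ^ 2)).add h1).deriv
  rw [checkM, funext hev]
  erw [hd]
  simp only [symM, Finset.sum_range_succ, Finset.range_zero, Finset.sum_empty]
  simp
  ring

/-- As `∂_τ² L = 6τ + 2b`, its second time derivative at frozen `τ` contributes `b''/6`. -/
lemma checkN_eq (ha : AnalyticCoeffs a T) (ht : t ∈ Ioo 0 T) (τ : ℂ)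
    (ξ : EuclideanSpace ℝ (Fin n)) :
    checkN a t τ ξ = coeffSum a 1 0 t ξ * τ + coeffSum a 0 1 t ξ +
      ((-1 : ℝ) * (dtc (coeffSum a 2 0) t ξ * τ) + (-1 / 2 : ℝ) * dtc (coeffSum a 1 1) t ξ) +
      (1 / 6 : ℝ) * dtc (dtc (coeffSum a 2 1)) t ξ := by
  have hevM : ∀ s, (derivative (symM a s ξ)).eval τ =
      (2 * τ) * coeffSum a 2 0 s ξ + coeffSum a 1 1 s ξ := fun s => by
    simp only [symM, Finset.sum_range_succ, Finset.range_zero, Finset.sum_empty]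
    simp
    ring
  have hevL : ∀ s, (derivative (derivative (symL a s ξ))).eval τ =
      6 * τ + 2 * coeffSum a 2 1 s ξ := fun s => by
    rw [symL_eq]
    simp
    ring
  have h2 : HasDerivAt (fun s => coeffSum a 2 0 s ξ) (dtc (coeffSum a 2 0) t ξ) t :=
    (analyticOnNhd_coeffSum ha le_rfl (by norm_num) ξ t
      (Ioo_subset_Icc_self ht)).differentiableAt.hasDerivAt
  have h1 : HasDerivAt (fun s => coeffSum a 1 1 s ξ) (dtc (coeffSum a 1 1) t ξ) t :=
    (analyticOnNhd_coeffSum ha one_le_two (by norm_num) ξ t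
      (Ioo_subset_Icc_self ht)).differentiableAt.hasDerivAt
  have hd := ((h2.const_mul (2 * τ)).add h1).deriv
  have hdd : iteratedDeriv 2 (fun s => 6 * τ + 2 * coeffSum a 2 1 s ξ) t =
      2 * dtc (dtc (coeffSum a 2 1)) t ξ := by
    rw [iteratedDeriv_succ, iteratedDeriv_one]
    have : deriv (fun s => 6 * τ + 2 * coeffSum a 2 1 s ξ) =
        fun s => 2 * dtc (coeffSum a 2 1) s ξ := by
      funext s
      rw [deriv_const_add, deriv_const_mul_field]
      rfl
    rw [this, deriv_const_mul_field]
    rfl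
  rw [checkN, funext hevM, funext hevL, hdd]
  erw [hd]
  simp only [symN, Finset.sum_range_succ, Finset.range_zero, Finset.sum_empty]
  simp
  ring

lemma cTame_checkM (ha : AnalyticCoeffs a T) {x : ℝ → EuclideanSpace ℝ (Fin n) → ℝ}
    (hx : DTame T x) : CTame T fun t ξ => checkM a t (x t ξ) ξ := by
  have X := hx.ofReal
  have m2 := (cSep_coeffSum ha (j := 2) (k := 0) le_rfl (by norm_num)).cTame
  have m1 := (cSep_coeffSum ha (j := 1) (k := 1) one_le_two (by norm_num)).cTame
  have m0 := (cSep_coeffSum ha (j := 0) (k := 2) zero_le_two (by norm_num)).cTame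
  have d2 := (cSep_coeffSum ha (j := 2) (k := 1) le_rfl le_rfl).dtc.cTame
  have d1 := (cSep_coeffSum ha (j := 1) (k := 2) one_le_two le_rfl).dtc.cTame
  exact ((((m2.mul (X.mul X)).add (m1.mul X)).add m0).add
    (((d2.mul X).const_mul (-1)).add (d1.const_mul (-1 / 2)))).congr
      fun t ht ξ => checkM_eq ha ht _ ξ

lemma cTame_checkN (ha : AnalyticCoeffs a T) {x : ℝ → EuclideanSpace ℝ (Fin n) → ℝ}
    (hx : DTame T x) : CTame T fun t ξ => checkN a t (x t ξ) ξ := by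
  have X := hx.ofReal
  have n1 := (cSep_coeffSum ha (j := 1) (k := 0) one_le_two (by norm_num)).cTame
  have n0 := (cSep_coeffSum ha (j := 0) (k := 1) zero_le_two (by norm_num)).cTame
  have d2 := (cSep_coeffSum ha (j := 2) (k := 0) le_rfl (by norm_num)).dtc.cTame
  have d1 := (cSep_coeffSum ha (j := 1) (k := 1) one_le_two (by norm_num)).dtc.cTame
  have dd := (cSep_coeffSum ha (j := 2) (k := 1) le_rfl le_rfl).dtc.dtc.cTame
  exact ((((n1.mul X).add n0).add
    (((d2.mul X).const_mul (-1)).add (d1.const_mul (-1 / 2)))).add (dd.const_mul (1 / 6))).congr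
      fun t ht ξ => checkN_eq ha ht _ ξ

end LowerOrder

/-! ### The four logarithmic conditions. -/

section Integrands

variable {n : ℕ} {a : Coeffs n} {T : ℝ}

lemma dt_sub {f g : ℝ → EuclideanSpace ℝ (Fin n) → ℝ} (hf : Tame T f) (hg : Tame T g) :
    ∀ t ∈ Ioo 0 T, ∀ ξ, dt (f - g) t ξ = dt f t ξ - dt g t ξ := fun _ ht ξ =>
  ((hf.hasDerivAt ht ξ).sub (hg.hasDerivAt ht ξ)).deriv

lemma one_le_abs_lam_sub (hL : WeaklyHyperbolic a T) {t : ℝ} (ht : t ∈ Icc 0 T)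
    (ξ : EuclideanSpace ℝ (Fin n)) {p : Fin 3 × Fin 3} (hp : p ∈ S2) :
    1 ≤ |lam a p.1 t ξ - lam a p.2 t ξ| := by
  obtain ⟨h1, h2, h3, -⟩ := lam_gaps hL ht ξ
  refine (one_le_sq_iff_one_le_abs _).1 ?_
  simp only [S2, Finset.mem_insert, Finset.mem_singleton] at hp
  rcases hp with rfl | rfl | rfl <;> simp only <;> linarith

theorem logCondition_integrand1 (hT : 0 < T) (ha : AnalyticCoeffs a T)
    (hL : WeaklyHyperbolic a T) : LogCondition T univ (integrand1 a) := by
  have heq : integrand1 a = ∑ p ∈ S2, fun t ξ => |dt (lam a p.1) t ξ - dt (lam a p.2) t ξ| /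
      |lam a p.1 t ξ - lam a p.2 t ξ| := by
    funext t ξ
    simp [integrand1, Finset.sum_apply, dt]
  rw [heq]
  have hge : ∀ p ∈ S2, ∀ t ∈ Ioo 0 T, ∀ ξ, 1 ≤ |lam a p.1 t ξ - lam a p.2 t ξ| :=
    fun p hp t ht ξ => one_le_abs_lam_sub hL (Ioo_subset_Icc_self ht) ξ hp
  refine LogBdd.logCondition_univ hT (LogBdd.sum hT _ fun p hp => ?_)
    (SmallBd.sum _ fun p hp => ?_)
  · have h1 := (tame_lam ha hL p.1).1
    have h2 := (tame_lam ha hL p.2).1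
    -- The gap is at least 1, so `gap + 1 ≤ 2 * gap`; this is the factor 2.
    refine (((h1.sub h2).logBdd hT).const_mul two_pos).mono hT (fun ξ => ?_) fun t ht ξ => ?_
    · refine ContinuousOn.div ?_ ?_ fun t ht => (one_pos.trans_le (hge p hp t ht ξ)).ne'
      · exact ((h1.2.1 ξ).continuousOn.sub (h2.2.1 ξ).continuousOn).abs
      · exact ((h1.1.1 ξ).continuousOn.sub (h2.1.1 ξ).continuousOn).abs
    · have h3 := hge p hp t ht ξ
      rw [dt_sub h1.1 h2.1 t ht ξ]
      simp only [Pi.sub_apply]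
      set D := |dt (lam a p.1) t ξ - dt (lam a p.2) t ξ|
      set G := |lam a p.1 t ξ - lam a p.2 t ξ|
      have hD : 0 ≤ D := abs_nonneg _
      rw [abs_of_nonneg (by positivity), abs_of_nonneg (by positivity),
        div_le_iff₀ (by positivity), mul_assoc, div_mul_eq_mul_div, mul_div_assoc',
        le_div_iff₀ (by positivity)]
      nlinarith
  · refine ((tame_lam ha hL p.1).2.2.1.sub (tame_lam ha hL p.2).2.2.1).mono fun t ht ξ => ?_
    have h3 := hge p hp t ht ξ
    rw [abs_div, abs_abs, abs_abs]
    exact div_le_self (abs_nonneg _) h3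

theorem logCondition_integrand2 (hT : 0 < T) (ha : AnalyticCoeffs a T)
    (hL : WeaklyHyperbolic a T) : LogCondition T univ (integrand2 a) := by
  have heq : integrand2 a = ∑ p ∈ S2, fun t ξ =>
      |dt (dt (lam a p.1)) t ξ - dt (dt (lam a p.2)) t ξ| /
        (|dt (lam a p.1) t ξ - dt (lam a p.2) t ξ| + 1) := by
    funext t ξ
    simp only [integrand2, Finset.sum_apply, iteratedDeriv_succ, iteratedDeriv_zero]
    rfl
  rw [heq]
  refine LogBdd.logCondition_univ hT (LogBdd.sum hT _ fun p hp => ?_)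
    (SmallBd.sum _ fun p hp => ?_)
  · have h1 := (tame_lam ha hL p.1).2.1
    have h2 := (tame_lam ha hL p.2).2.1
    refine ((h1.sub h2).logBdd hT).mono hT (fun ξ => ?_) fun t ht ξ => ?_
    · refine ContinuousOn.div ?_ ?_ fun t ht => by positivity
      · exact ((h1.2.1 ξ).continuousOn.sub (h2.2.1 ξ).continuousOn).abs
      · exact ((h1.1.1 ξ).continuousOn.sub (h2.1.1 ξ).continuousOn).abs.add continuousOn_const
    · rw [dt_sub h1.1 h2.1 t ht ξ]
      rfl
  · refine ((tame_lam ha hL p.1).2.2.2.sub (tame_lam ha hL p.2).2.2.2).mono fun t ht ξ => ?_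
    rw [abs_div, abs_abs, abs_of_pos (a := _ + 1) (by positivity)]
    exact div_le_self (abs_nonneg _) (by simp)

/-- The restriction `|ξ| ≥ R` cannot be dropped in general: at `ξ = 0` the outer roots are `±√6` and
`M̌ = 6 a_{2,0}(t)` there, which may vary with `t`. -/
theorem logCondition_integrand3 (hT : 0 < T) (ha : AnalyticCoeffs a T)
    (hL : WeaklyHyperbolic a T) {R : ℝ} (hR : 0 < R) :
    LogCondition T {ξ | R ≤ ‖ξ‖} (integrand3 a) := by
  have := LogBdd.sum hT Finset.univ fun (j : Fin 3) _ =>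
    (cTame_checkM ha (tame_lam ha hL j).1).logBdd hT
  refine LogBdd.logCondition_of_le ?_ hR
  convert this using 1
  funext t ξ
  simp [integrand3, Finset.sum_apply]

theorem logCondition_integrand4 (hT : 0 < T) (ha : AnalyticCoeffs a T)
    (hL : WeaklyHyperbolic a T) {R : ℝ} (hR : 0 < R) :
    LogCondition T {ξ | R ≤ ‖ξ‖} (integrand4 a) := by
  have := LogBdd.sum hT Finset.univ fun (j : Fin 2) _ =>
    (cTame_checkN ha (tame_mu ha hL j)).logBdd hT
  refine LogBdd.logCondition_of_le ?_ hR
  convert this using 1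
  funext t ξ
  simp [integrand4, Finset.sum_apply]

end Integrands

end ThirdOrder

theorem mainTheorem3 (n : ℕ) (T : ℝ) (hT : 0 < T) (a : ThirdOrder.Coeffs n)
    (ha : ThirdOrder.AnalyticCoeffs a T) (hL : ThirdOrder.WeaklyHyperbolic a T) :
    ThirdOrder.RootsRegular a T ∧
    ThirdOrder.LogCondition T Set.univ (ThirdOrder.integrand1 a) ∧
    ThirdOrder.LogCondition T Set.univ (ThirdOrder.integrand2 a) ∧
    (∀ R : ℝ, 0 < R →
      ThirdOrder.LogCondition T {ξ | R ≤ ‖ξ‖} (ThirdOrder.integrand3 a)) ∧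
    (∀ R : ℝ, 0 < R →
      ThirdOrder.LogCondition T {ξ | R ≤ ‖ξ‖} (ThirdOrder.integrand4 a)) :=
  ⟨ThirdOrder.rootsRegular ha hL, ThirdOrder.logCondition_integrand1 hT ha hL,
    ThirdOrder.logCondition_integrand2 hT ha hL,
    fun _ hR => ThirdOrder.logCondition_integrand3 hT ha hL hR,
    fun _ hR => ThirdOrder.logCondition_integrand4 hT ha hL hR⟩
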